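/- Let $\mathcal C$ be an autonomous category, i.e. a monoidal category with chosen left duals $({}^\vee X,\ \mathrm{ev}_X\colon {}^\vee X\otimes X\to \mathbb 1,\ \mathrm{coev}_X\colon \mathbb 1\to X\otimes {}^\vee X)$ and right duals $(X^\vee,\ \widetilde{\mathrm{ev}}_X\colon X\otimes X^\vee\to\mathbb 1,\ \widetilde{\mathrm{coev}}_X\colon\mathbb 1\to X^\vee\otimes X)$ of all objects $X$ (associativity and unit constraints are suppressed). A *bimonad* on $\mathcal C$ is a monad $(T,\mu,\eta)$ on $\mathcal C$ with a comonoidal structure $T_2(X,Y)\colon T(X\otimes Y)\to T(X)\otimes T(Y)$, $T_0\colon T(\mathbb 1)\to\mathbb 1$ on the functor $T$ such that $\mu$ and $\eta$ are comonoidal. A *left antipode* is a natural family $s^l_X\colon T({}^\vee T(X))\to {}^\vee X$ with $$T_0\,T(\mathrm{ev}_X)\,T({}^\vee\eta_X\otimes \mathrm{id}_X)=\mathrm{ev}_{T(X)}\bigl(s^l_{T(X)}T({}^\vee\mu_X)\otimes\mathrm{id}_{T(X)}\bigr)T_2({}^\vee T(X),X),$$ $$(\eta_X\otimes\mathrm{id}_{{}^\vee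 X})\,\mathrm{coev}_X\,T_0=(\mu_X\otimes s^l_X)\,T_2(T(X),{}^\vee T(X))\,T(\mathrm{coev}_{T(X)}),$$ and a *right antipode* is a natural family $s^r_X\colon T(T(X)^\vee)\to X^\vee$ with $$T_0\,T(\widetilde{\mathrm{ev}}_X)\,T(\mathrm{id}_X\otimes\eta_X^\vee)=\widetilde{\mathrm{ev}}_{T(X)}\bigl(\mathrm{id}_{T(X)}\otimes s^r_{T(X)}T(\mu_X^\vee)\bigr)T_2(X,T(X)^\vee),$$ $$(\mathrm{id}_{X^\vee}\otimes\eta_X)\,\widetilde{\mathrm{coev}}_X\,T_0=(s^r_X\otimes\mu_X)\,T_2(T(X)^\vee,T(X))\,T(\widetilde{\mathrm{coev}}_{T(X)}).$$ A *Hopf monad* is a bimonad which has a left antipode and a right antipode. Let $T$ be a Hopf monad on $\mathcal C$. The object $T(\mathbb 1)$ is a coalgebra with coproduct $T_2(\mathbb 1,\mathbb 1)$ and counit $T_0$. A *right Hopf $T$-module* is a triple $(M,r,\rho)$ where $(M,r\colon T(M)\to M)$ is a $T$-module (an algebra over the monad $T$), $(M,\rho\colon M\to M\otimes T(\mathbb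 1))$ is a right $T(\mathbb 1)$-comodule and $\rho r=(r\otimes\mu_{\mathbb 1})T_2(M,T(\mathbb 1))T(\rho)$. It *admits coinvariants* if the pair $(\rho,\ \mathrm{id}_M\otimes\eta_{\mathbb 1})$ has an equalizer, and these are *preserved by $T$* if $T$ maps this equalizer to an equalizer of $(T(\rho),\ T(\mathrm{id}_M\otimes\eta_{\mathbb 1}))$. Left Hopf $T$-modules $(M,r,\rho\colon M\to T(\mathbb 1)\otimes M)$ and their coinvariants, the equalizer of $(\rho,\ \eta_{\mathbb 1}\otimes\mathrm{id}_M)$, are defined symmetrically. For an endofunctor $K$ of $\mathcal C$, a *$K$-valued left* (resp. *right*) *integral* of $T$ is a natural transformation $c\colon T\to K$ such that $(\mathrm{id}_{T(\mathbb 1)}\otimes c_X)T_2(\mathbb 1,X)=\eta_{\mathbb 1}\otimes c_X$ (resp. $(c_X\otimes\mathrm{id}_{T(\mathbb 1)})T_2(X,\mathbb 1)=c_X\otimes\eta_{\mathbb 1}$) for all objects $X$. A left (resp. right) integral $\lambda\colon T\to I$ is *universal* if every left (resp. right) integral $c\colon T\to K$, for every endofunctor $K$ of $\mathcal C$, is $c=f\lambda$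 for a unique natural transformation $f\colon I\to K$. For an endofunctor $F$ of $\mathcal C$, define endofunctors $F^!$ and ${}^!F$ by $F^!(X)=F({}^\vee X)^\vee$ and ${}^!F(X)={}^\vee F(X^\vee)$, and similarly on morphisms. **Theorem.** Let $T$ be a Hopf monad on an autonomous category $\mathcal C$. Assume that left Hopf $T$-modules and right Hopf $T$-modules admit coinvariants which are preserved by $T$ (such is the case if equalizers exist in $\mathcal C$ and are preserved by $T$). Suppose moreover that $T$ is conservative, i.e. a morphism $f$ of $\mathcal C$ is an isomorphism whenever $T(f)$ is. Then there exist two auto-equivalences $I_l$ and $I_r$ of the category $\mathcal C$, a universal $I_l$-valued left integral of $T$, and a universal $I_r$-valued right integral of $T$. Moreover $I_l^!$ is quasi-inverse to $I_r$, and ${}^!I_r$ is quasi-inverse to $I_l$. -/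

import Mathlib

open CategoryTheory MonoidalCategory Limits Functor.OplaxMonoidal

universe v u

namespace HopfMonad

variable {C : Type u} [Category.{v} C] [MonoidalCategory C]

/-- A bimonad: a monad `T` on a monoidal category whose underlying functor is comonoidal
(`OplaxMonoidal`, with structure maps `δ T X Y : T (X ⊗ Y) ⟶ T X ⊗ T Y` and `η T : T 𝟙 ⟶ 𝟙`) and
whose multiplication `T.μ` and unit `T.η` are comonoidal morphisms. -/
class IsBimonad (T : Monad C) [T.toFunctor.OplaxMonoidal] : Prop where
  mul_tensor (X Y : C) :
    T.μ.app (X ⊗ Y) ≫ δ T.toFunctor X Y =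
      T.map (δ T.toFunctor X Y) ≫ δ T.toFunctor (T.obj X) (T.obj Y) ≫ (T.μ.app X ⊗ₘ T.μ.app Y)
  mul_counit :
    T.μ.app (𝟙_ C) ≫ η T.toFunctor = T.map (η T.toFunctor) ≫ η T.toFunctor
  unit_tensor (X Y : C) :
    T.η.app (X ⊗ Y) ≫ δ T.toFunctor X Y = T.η.app X ⊗ₘ T.η.app Y
  unit_counit :
    T.η.app (𝟙_ C) ≫ η T.toFunctor = 𝟙 (𝟙_ C)

section Duals

variable [RigidCategory C]

/-! Convention on duals. A *left dual* of `X` is an object `L` with an evaluation `L ⊗ X ⟶ 𝟙` and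
a coevaluation `𝟙 ⟶ X ⊗ L` satisfying the triangle identities. This is Mathlib's `Xᘁ` (which Mathlib
calls a right dual). A *right dual* of `X` is an object `R` with an evaluation `X ⊗ R ⟶ 𝟙` and a
coevaluation `𝟙 ⟶ R ⊗ X`. This is Mathlib's `ᘁX` (which Mathlib calls a left dual).
The names below use the convention just stated. -/

/-- A left antipode for `T`: a natural family `T (ᵛ(T X)) ⟶ ᵛX`, where `ᵛX` is the left dual
(Mathlib's `Xᘁ`), satisfying the two antipode axioms. -/
structure LeftAntipode (T : Monad C) [T.toFunctor.OplaxMonoidal] where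
  app (X : C) : T.obj ((T.obj X)ᘁ) ⟶ Xᘁ
  naturality {X Y : C} (f : X ⟶ Y) :
    T.map ((T.map f)ᘁ) ≫ app X = app Y ≫ fᘁ
  evaluation (X : C) :
    T.map ((T.η.app X)ᘁ ▷ X ≫ ε_ X (Xᘁ)) ≫ η T.toFunctor =
      δ T.toFunctor ((T.obj X)ᘁ) X ≫
        (T.map ((T.μ.app X)ᘁ) ≫ app (T.obj X)) ▷ T.obj X ≫ ε_ (T.obj X) ((T.obj X)ᘁ)
  coevaluation (X : C) :
    η T.toFunctor ≫ η_ X (Xᘁ) ≫ T.η.app X ▷ Xᘁ =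
      T.map (η_ (T.obj X) ((T.obj X)ᘁ)) ≫ δ T.toFunctor (T.obj X) ((T.obj X)ᘁ) ≫
        (T.μ.app X ⊗ₘ app X)

/-- A right antipode for `T`: a natural family `T ((T X)ᵛ) ⟶ Xᵛ`, where `Xᵛ` is the right dual
(Mathlib's `ᘁX`), satisfying the two antipode axioms. -/
structure RightAntipode (T : Monad C) [T.toFunctor.OplaxMonoidal] where
  app (X : C) : T.obj (ᘁ(T.obj X) : C) ⟶ (ᘁX : C)
  naturality {X Y : C} (f : X ⟶ Y) :
    T.map (ᘁ(T.map f)) ≫ app X = app Y ≫ (ᘁf)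
  evaluation (X : C) :
    T.map (X ◁ (ᘁ(T.η.app X)) ≫ ε_ (ᘁX : C) X) ≫ η T.toFunctor =
      δ T.toFunctor X (ᘁ(T.obj X) : C) ≫
        T.obj X ◁ (T.map (ᘁ(T.μ.app X)) ≫ app (T.obj X)) ≫ ε_ (ᘁ(T.obj X) : C) (T.obj X)
  coevaluation (X : C) :
    η T.toFunctor ≫ η_ (ᘁX : C) X ≫ (ᘁX : C) ◁ T.η.app X =
      T.map (η_ (ᘁ(T.obj X) : C) (T.obj X)) ≫ δ T.toFunctor (ᘁ(T.obj X) : C) (T.obj X) ≫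
        (app X ⊗ₘ T.μ.app X)

/-- A Hopf monad on an autonomous category: a bimonad which has a left antipode and a right
antipode. -/
class IsHopfMonad (T : Monad C) [T.toFunctor.OplaxMonoidal] : Prop extends IsBimonad T where
  exists_leftAntipode : Nonempty (LeftAntipode T)
  exists_rightAntipode : Nonempty (RightAntipode T)

/-- The endofunctor `F^!`, sending `X` to the right dual of `F (left dual of X)`. -/
def rexcl (F : C ⥤ C) : C ⥤ C where
  obj X := (ᘁ(F.obj (Xᘁ)) : C)
  map f := (ᘁ(F.map (fᘁ)))
  map_id X := by simp
  map_comp f g := by rw [comp_rightAdjointMate, F.map_comp, comp_leftAdjointMate]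

/-- The endofunctor `^!F`, sending `X` to the left dual of `F (right dual of X)`. -/
def lexcl (F : C ⥤ C) : C ⥤ C where
  obj X := (F.obj (ᘁX : C))ᘁ
  map f := (F.map (ᘁf))ᘁ
  map_id X := by simp
  map_comp f g := by rw [comp_leftAdjointMate, F.map_comp, comp_rightAdjointMate]

end Duals

section HopfModules

variable (T : Monad C) [T.toFunctor.OplaxMonoidal]

/-- The coproduct `T 𝟙 ⟶ T 𝟙 ⊗ T 𝟙` of the coalgebra `T 𝟙`, whose counit is `η T : T 𝟙 ⟶ 𝟙`. -/
def comul : T.obj (𝟙_ C) ⟶ T.obj (𝟙_ C) ⊗ T.obj (𝟙_ C) :=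
  T.map (λ_ (𝟙_ C)).inv ≫ δ T.toFunctor (𝟙_ C) (𝟙_ C)

/-- A right Hopf `T`-module `(M, r, ρ)`: a `T`-module `(M, r)` with a right coaction
`ρ : M ⟶ M ⊗ T 𝟙` of the coalgebra `T 𝟙` which is `T`-linear. -/
structure RightHopfModule extends T.Algebra where
  coact : A ⟶ A ⊗ T.obj (𝟙_ C)
  coact_counit : coact ≫ A ◁ η T.toFunctor = (ρ_ A).inv
  coact_comul : coact ≫ coact ▷ T.obj (𝟙_ C) ≫ (α_ _ _ _).hom = coact ≫ A ◁ comul T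
  act_coact :
    a ≫ coact = T.map coact ≫ δ T.toFunctor A (T.obj (𝟙_ C)) ≫ (a ⊗ₘ T.μ.app (𝟙_ C))

/-- A left Hopf `T`-module `(M, r, ρ)`: a `T`-module `(M, r)` with a left coaction
`ρ : M ⟶ T 𝟙 ⊗ M` of the coalgebra `T 𝟙` which is `T`-linear. -/
structure LeftHopfModule extends T.Algebra where
  coact : A ⟶ T.obj (𝟙_ C) ⊗ A
  coact_counit : coact ≫ η T.toFunctor ▷ A = (λ_ A).inv
  coact_comul : coact ≫ T.obj (𝟙_ C) ◁ coact = coact ≫ comul T ▷ A ≫ (α_ _ _ _).hom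
  act_coact :
    a ≫ coact = T.map coact ≫ δ T.toFunctor (T.obj (𝟙_ C)) A ≫ (T.μ.app (𝟙_ C) ⊗ₘ a)

variable {T}

/-- The trivial right coaction `id_M ⊗ η_𝟙 : M ⟶ M ⊗ T 𝟙`. -/
def rightTrivialCoaction (T : Monad C) (M : C) : M ⟶ M ⊗ T.obj (𝟙_ C) :=
  (ρ_ M).inv ≫ M ◁ T.η.app (𝟙_ C)

/-- The trivial left coaction `η_𝟙 ⊗ id_M : M ⟶ T 𝟙 ⊗ M`. -/
def leftTrivialCoaction (T : Monad C) (M : C) : M ⟶ T.obj (𝟙_ C) ⊗ M :=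
  (λ_ M).inv ≫ T.η.app (𝟙_ C) ▷ M

/-- A right Hopf module admits coinvariants: its coaction and the trivial coaction have an
equalizer. -/
def RightHopfModule.AdmitsCoinvariants (M : RightHopfModule T) : Prop :=
  HasEqualizer M.coact (rightTrivialCoaction T M.A)

/-- `T` preserves the coinvariants of the right Hopf module `M`: it sends any equalizer of the
coaction and the trivial coaction to an equalizer of the images of these morphisms. -/
def RightHopfModule.CoinvariantsPreserved (M : RightHopfModule T) : Prop :=
  PreservesLimit (parallelPair M.coact (rightTrivialCoaction T M.A)) T.toFunctor

/-- A left Hopf module admits coinvariants: its coaction and the trivial coaction have an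
equalizer. -/
def LeftHopfModule.AdmitsCoinvariants (M : LeftHopfModule T) : Prop :=
  HasEqualizer M.coact (leftTrivialCoaction T M.A)

/-- `T` preserves the coinvariants of the left Hopf module `M`: it sends any equalizer of the
coaction and the trivial coaction to an equalizer of the images of these morphisms. -/
def LeftHopfModule.CoinvariantsPreserved (M : LeftHopfModule T) : Prop :=
  PreservesLimit (parallelPair M.coact (leftTrivialCoaction T M.A)) T.toFunctor

/-- Left Hopf `T`-modules and right Hopf `T`-modules admit coinvariants which are preserved
by `T`. -/
def HopfModulesAdmitPreservedCoinvariants (T : Monad C) [T.toFunctor.OplaxMonoidal] : Prop :=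
  (∀ M : LeftHopfModule T, M.AdmitsCoinvariants ∧ M.CoinvariantsPreserved) ∧
  (∀ M : RightHopfModule T, M.AdmitsCoinvariants ∧ M.CoinvariantsPreserved)

end HopfModules

section Integrals

variable (T : Monad C) [T.toFunctor.OplaxMonoidal]

/-- `c : T ⟶ K` is a `K`-valued left integral of `T`:
`(id_{T 𝟙} ⊗ c_X) T₂(𝟙, X) = η_𝟙 ⊗ c_X` as morphisms `T X ≅ T (𝟙 ⊗ X) ⟶ T 𝟙 ⊗ K X`. -/
def IsLeftIntegral {K : C ⥤ C} (c : T.toFunctor ⟶ K) : Prop :=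
  ∀ X : C, T.map (λ_ X).inv ≫ δ T.toFunctor (𝟙_ C) X ≫ T.obj (𝟙_ C) ◁ c.app X =
    (λ_ (T.obj X)).inv ≫ (T.η.app (𝟙_ C) ⊗ₘ c.app X)

/-- `c : T ⟶ K` is a `K`-valued right integral of `T`:
`(c_X ⊗ id_{T 𝟙}) T₂(X, 𝟙) = c_X ⊗ η_𝟙` as morphisms `T X ≅ T (X ⊗ 𝟙) ⟶ K X ⊗ T 𝟙`. -/
def IsRightIntegral {K : C ⥤ C} (c : T.toFunctor ⟶ K) : Prop :=
  ∀ X : C, T.map (ρ_ X).inv ≫ δ T.toFunctor X (𝟙_ C) ≫ c.app X ▷ T.obj (𝟙_ C) =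
    (ρ_ (T.obj X)).inv ≫ (c.app X ⊗ₘ T.η.app (𝟙_ C))

/-- A universal left integral: every left integral factors uniquely through it. -/
def IsUniversalLeftIntegral {I : C ⥤ C} (l : T.toFunctor ⟶ I) : Prop :=
  IsLeftIntegral T l ∧
    ∀ (K : C ⥤ C) (c : T.toFunctor ⟶ K), IsLeftIntegral T c → ∃! f : I ⟶ K, c = l ≫ f

/-- A universal right integral: every right integral factors uniquely through it. -/
def IsUniversalRightIntegral {I : C ⥤ C} (l : T.toFunctor ⟶ I) : Prop :=
  IsRightIntegral T l ∧
    ∀ (K : C ⥤ C) (c : T.toFunctor ⟶ K), IsRightIntegral T c → ∃! f : I ⟶ K, c = l ≫ f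

end Integrals

/-- Two endofunctors are quasi-inverse to each other: both composites are isomorphic to the
identity functor. -/
def AreQuasiInverse (F G : C ⥤ C) : Prop :=
  Nonempty (F ⋙ G ≅ 𝟭 C) ∧ Nonempty (G ⋙ F ≅ 𝟭 C)

end HopfMonad

/-!
Let `T` be a Hopf monad. An antipode makes the dual of a `T`-module a `T`-module for which the
evaluation and the coevaluation are linear (`RightAntipode.isLinearPairing`,
`LeftAntipode.isLinearPairing`). For a module `(M, a)` this gives an explicit inverse of the fusion
operators `T (M ⊗ Y) ⟶ M ⊗ T Y` and `T (Y ⊗ M) ⟶ T Y ⊗ M`, and so isomorphisms `T M ≅ M ⊗ T 𝟙` and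
`T M ≅ T 𝟙 ⊗ M`. If `M` is a Hopf module, the first of these carries the image under `T` of the
coinvariants pair of `M` to the pair whose split equalizer is the coaction of `M`. Therefore `M` is
the free module on its object of coinvariants, provided that `T` preserves it
(`RightHopfModule.isIso_map_act`, `LeftHopfModule.isIso_map_act`). For the free Hopf module `T X`
and conservative `T` this says that the unit `X ⟶ T X` is the object of coinvariants
(`isEqualizer_freeRightCoact`, `isEqualizer_freeLeftCoact`).

The right dual of the free left Hopf module `T X` is a right Hopf module, hence isomorphic to `T Z`
for some `Z`. The isomorphism amounts to a linear perfect pairing `ω : T X ⊗ T Z ⟶ 𝟙` for which the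
two coactions are adjoint. Through `ω`, a form on `T X ⊗ W` with the left integral property is the
same as a coinvariant morphism `W ⟶ T Z`, that is, as a morphism `W ⟶ Z`; likewise a form on
`W ⊗ T Z` with the right integral property is the same as a morphism `W ⟶ X`
(`isUniversalPairing_evaluation`). The left dual of a free right Hopf module shows in the same way
that every object occurs as a `Z`. These two universal properties make `X ↦ Z` an anti-equivalence
`E` of the category (`exists_pairingFunctor`); the invertible fusion operators are what allows
naturality of `ω` to be checked on its restriction to `T X ⊗ Z` or to `X ⊗ T Z`.

Passing from forms to morphisms by duality, the restriction of `ω` to `T X ⊗ Z` becomes a universal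
left integral with values in `I_l X = ᵛ(E X)`, and the restriction to `X ⊗ T Z` a universal right
integral with values in `I_r X = (E⁻¹ X)ᵛ` (`exists_isUniversalLeftIntegral`,
`exists_isUniversalRightIntegral_of_pairing`). Since left and right duals are inverse
anti-equivalences, `I_l^!` is `X ↦ E (ᵛX)` and `^!I_r` is `X ↦ E⁻¹ (Xᵛ)` up to isomorphism. They are
quasi-inverse to `I_r` and to `I_l`, which in particular makes `I_l` and `I_r` equivalences.
-/

namespace HopfMonad

/-! ### Actions of a comonoidal endofunctor and linear morphisms -/

section Actions

variable {C : Type u} [Category.{v} C] {F : C ⥤ C}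

/-- `f : M ⟶ N` intertwines `a : F M ⟶ M` and `b : F N ⟶ N`. The morphisms `a` and `b` need not
satisfy any module axiom. -/
def IsLinear {M N : C} (a : F.obj M ⟶ M) (b : F.obj N ⟶ N) (f : M ⟶ N) : Prop :=
  F.map f ≫ b = a ≫ f

namespace IsLinear

variable {M N P : C} {a : F.obj M ⟶ M} {b : F.obj N ⟶ N} {c : F.obj P ⟶ P}

theorem comp {f : M ⟶ N} {g : N ⟶ P} (hf : IsLinear a b f) (hg : IsLinear b c g) :
    IsLinear a c (f ≫ g) := by
  unfold IsLinear at *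
  rw [F.map_comp, Category.assoc, hg, reassoc_of% hf]

theorem inv {f : M ≅ N} (hf : IsLinear a b f.hom) : IsLinear b a f.inv := by
  unfold IsLinear at *
  rw [Iso.eq_comp_inv, Category.assoc, ← hf, ← F.map_comp_assoc, Iso.inv_hom_id, F.map_id,
    Category.id_comp]

end IsLinear

variable [MonoidalCategory C] [F.OplaxMonoidal]

variable (F) in
/-- The diagonal action on `M ⊗ N` determined by morphisms `a : F M ⟶ M` and `b : F N ⟶ N`. The
action on the unit object which is neutral for it is `η F`. -/
def tensorAct {M N : C} (a : F.obj M ⟶ M) (b : F.obj N ⟶ N) : F.obj (M ⊗ N) ⟶ M ⊗ N :=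
  δ F M N ≫ (a ⊗ₘ b)

namespace IsLinear

variable {M N P : C} {a : F.obj M ⟶ M} {b : F.obj N ⟶ N}

theorem whiskerLeft (c : F.obj P ⟶ P) {f : M ⟶ N} (hf : IsLinear a b f) :
    IsLinear (tensorAct F c a) (tensorAct F c b) (P ◁ f) := by
  unfold IsLinear tensorAct at *
  rw [← δ_natural_right_assoc, MonoidalCategory.tensorHom_def', MonoidalCategory.tensorHom_def',
    ← whiskerLeft_comp_assoc, hf]
  simp [← whisker_exchange]

theorem whiskerRight {f : M ⟶ N} (hf : IsLinear a b f) (c : F.obj P ⟶ P) :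
    IsLinear (tensorAct F a c) (tensorAct F b c) (f ▷ P) := by
  unfold IsLinear tensorAct at *
  rw [← δ_natural_left_assoc, MonoidalCategory.tensorHom_def, MonoidalCategory.tensorHom_def,
    ← comp_whiskerRight_assoc, hf]
  simp [whisker_exchange]

theorem associator (a : F.obj M ⟶ M) (b : F.obj N ⟶ N) (c : F.obj P ⟶ P) :
    IsLinear (tensorAct F (tensorAct F a b) c) (tensorAct F a (tensorAct F b c))
      (α_ M N P).hom := by
  unfold IsLinear tensorAct
  calc _ = (F.map (α_ M N P).hom ≫ δ F M (N ⊗ P) ≫ F.obj M ◁ δ F N P) ≫ (a ⊗ₘ (b ⊗ₘ c)) := by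
        simp only [Category.assoc, MonoidalCategory.tensorHom_def', whiskerLeft_comp]
    _ = _ := by
        rw [← oplax_associativity]
        simp [MonoidalCategory.tensorHom_def]

theorem leftUnitor (a : F.obj M ⟶ M) :
    IsLinear (tensorAct F (η F) a) a (λ_ M).hom := by
  unfold IsLinear tensorAct
  rw [← left_unitality_hom]
  simp [MonoidalCategory.tensorHom_def]

theorem rightUnitor (a : F.obj M ⟶ M) :
    IsLinear (tensorAct F a (η F)) a (ρ_ M).hom := by
  unfold IsLinear tensorAct
  rw [← right_unitality_hom]
  simp [MonoidalCategory.tensorHom_def']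

end IsLinear

/-! ### Dual actions -/

variable (F) in
/-- The evaluation and the coevaluation of the exact pairing of `X` and `Y` are linear for the
actions `a` and `b`. -/
structure IsLinearPairing {X Y : C} [ExactPairing X Y] (a : F.obj X ⟶ X) (b : F.obj Y ⟶ Y) :
    Prop where
  evaluation : IsLinear (tensorAct F b a) (η F) (ε_ X Y)
  coevaluation : IsLinear (η F) (tensorAct F a b) (η_ X Y)

/-- An action on the second member of an exact pairing is determined by the action on the first:
by the triangle identity the identity of `Y` is a composite of linear morphisms from `b'` to
`b`. -/
theorem eq_of_isLinear_pairing_right {X Y : C} [ExactPairing X Y] {a : F.obj X ⟶ X}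
    {b b' : F.obj Y ⟶ Y} (hc : IsLinear (η F) (tensorAct F a b) (η_ X Y))
    (he : IsLinear (tensorAct F b' a) (η F) (ε_ X Y)) : b = b' := by
  have h : IsLinear b' b ((ρ_ Y).inv ≫ Y ◁ η_ X Y ≫ (α_ _ _ _).inv ≫ ε_ X Y ▷ Y ≫ (λ_ Y).hom) :=
    (IsLinear.rightUnitor b').inv.comp <| (hc.whiskerLeft b').comp <|
      (IsLinear.associator _ _ _).inv.comp <| (he.whiskerRight b).comp (IsLinear.leftUnitor b)
  have e : (ρ_ Y).inv ≫ Y ◁ η_ X Y ≫ (α_ _ _ _).inv ≫ ε_ X Y ▷ Y ≫ (λ_ Y).hom = 𝟙 Y := by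
    rw [ExactPairing.coevaluation_evaluation_assoc]
    simp
  rw [e] at h
  simpa [IsLinear] using h

/-- An action on the first member of an exact pairing is determined by the action on the
second. -/
theorem eq_of_isLinear_pairing_left {X Y : C} [ExactPairing X Y] {a a' : F.obj X ⟶ X}
    {b : F.obj Y ⟶ Y} (hc : IsLinear (η F) (tensorAct F a b) (η_ X Y))
    (he : IsLinear (tensorAct F b a') (η F) (ε_ X Y)) : a = a' := by
  have h : IsLinear a' a ((λ_ X).inv ≫ η_ X Y ▷ X ≫ (α_ _ _ _).hom ≫ X ◁ ε_ X Y ≫ (ρ_ X).hom) :=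
    (IsLinear.leftUnitor a').inv.comp <| (hc.whiskerRight a').comp <|
      (IsLinear.associator _ _ _).comp <| (he.whiskerLeft a).comp (IsLinear.rightUnitor a)
  have e : (λ_ X).inv ≫ η_ X Y ▷ X ≫ (α_ _ _ _).hom ≫ X ◁ ε_ X Y ≫ (ρ_ X).hom = 𝟙 X := by
    rw [ExactPairing.evaluation_coevaluation_assoc]
    simp
  rw [e] at h
  simpa [IsLinear] using h

/-! ### Fusion operators -/

variable (F) in
/-- The left fusion operator `F (M ⊗ Y) ⟶ M ⊗ F Y` of an action `a : F M ⟶ M`. -/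
def fusionLeft {M : C} (a : F.obj M ⟶ M) (Y : C) : F.obj (M ⊗ Y) ⟶ M ⊗ F.obj Y :=
  δ F M Y ≫ a ▷ F.obj Y

variable (F) in
/-- The right fusion operator `F (Y ⊗ M) ⟶ F Y ⊗ M` of an action `a : F M ⟶ M`. -/
def fusionRight {M : C} (a : F.obj M ⟶ M) (Y : C) : F.obj (Y ⊗ M) ⟶ F.obj Y ⊗ M :=
  δ F Y M ≫ F.obj Y ◁ a

section

variable {M N : C}

theorem fusionLeft_naturality (a : F.obj M ⟶ M) {Y Z : C} (f : Y ⟶ Z) :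
    F.map (M ◁ f) ≫ fusionLeft F a Z = fusionLeft F a Y ≫ M ◁ F.map f := by
  simp [fusionLeft, ← δ_natural_right_assoc, whisker_exchange]

theorem IsLinear.fusionLeft_comm {a : F.obj M ⟶ M} {b : F.obj N ⟶ N} {f : M ⟶ N}
    (h : IsLinear a b f) (Y : C) :
    F.map (f ▷ Y) ≫ fusionLeft F b Y = fusionLeft F a Y ≫ f ▷ F.obj Y := by
  unfold IsLinear at h
  simp only [fusionLeft, ← δ_natural_left_assoc, Category.assoc, ← comp_whiskerRight, h]

theorem fusionLeft_tensorAct (a : F.obj M ⟶ M) (b : F.obj N ⟶ N) (Y : C) :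
    fusionLeft F (tensorAct F a b) Y =
      F.map (α_ M N Y).hom ≫ fusionLeft F a (N ⊗ Y) ≫ M ◁ fusionLeft F b Y ≫ (α_ _ _ _).inv := by
  simp only [fusionLeft, tensorAct]
  calc _ = (δ F (M ⊗ N) Y ≫ δ F M N ▷ F.obj Y ≫ (α_ _ _ _).hom) ≫ a ▷ _ ≫ M ◁ b ▷ _ ≫
      (α_ _ _ _).inv := by simp [MonoidalCategory.tensorHom_def]
    _ = _ := by
      rw [oplax_associativity]
      simp [← whisker_exchange_assoc]

theorem fusionLeft_unit (Y : C) : fusionLeft F (η F) Y ≫ (λ_ _).hom = F.map (λ_ Y).hom := by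
  simp [fusionLeft]

theorem fusionRight_naturality (a : F.obj M ⟶ M) {Y Z : C} (f : Y ⟶ Z) :
    F.map (f ▷ M) ≫ fusionRight F a Z = fusionRight F a Y ≫ F.map f ▷ M := by
  simp [fusionRight, ← δ_natural_left_assoc, whisker_exchange]

theorem IsLinear.fusionRight_comm {a : F.obj M ⟶ M} {b : F.obj N ⟶ N} {f : M ⟶ N}
    (h : IsLinear a b f) (Y : C) :
    F.map (Y ◁ f) ≫ fusionRight F b Y = fusionRight F a Y ≫ F.obj Y ◁ f := by
  unfold IsLinear at h
  simp only [fusionRight, ← δ_natural_right_assoc, Category.assoc, ← whiskerLeft_comp, h]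

theorem fusionRight_tensorAct (a : F.obj M ⟶ M) (b : F.obj N ⟶ N) (Y : C) :
    fusionRight F (tensorAct F a b) Y =
      F.map (α_ Y M N).inv ≫ fusionRight F b (Y ⊗ M) ≫ fusionRight F a Y ▷ N ≫
        (α_ _ _ _).hom := by
  rw [← cancel_epi (F.map (α_ Y M N).hom), ← F.map_comp_assoc, Iso.hom_inv_id, F.map_id,
    Category.id_comp]
  simp only [fusionRight, tensorAct]
  calc _ = (F.map (α_ Y M N).hom ≫ δ F Y (M ⊗ N) ≫ F.obj Y ◁ δ F M N) ≫
        F.obj Y ◁ (a ⊗ₘ b) := by simp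
    _ = _ := by
      rw [← oplax_associativity]
      simp [whisker_exchange_assoc, MonoidalCategory.tensorHom_def']

theorem fusionRight_unit (Y : C) : fusionRight F (η F) Y ≫ (ρ_ _).hom = F.map (ρ_ Y).hom := by
  simp [fusionRight]

end

theorem exactPairing_triangle_left (X Y Z : C) [ExactPairing X Y] :
    Y ◁ ((λ_ Z).inv ≫ η_ X Y ▷ Z ≫ (α_ X Y Z).hom) ≫ (α_ Y X (Y ⊗ Z)).inv ≫
      ε_ X Y ▷ (Y ⊗ Z) ≫ (λ_ _).hom = 𝟙 (Y ⊗ Z) := by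
  calc _ = (ρ_ Y).inv ▷ Z ≫ (Y ◁ η_ X Y ≫ (α_ _ _ _).inv ≫ ε_ X Y ▷ Y) ▷ Z ≫
        (λ_ Y).hom ▷ Z := by monoidal
    _ = _ := by
      rw [ExactPairing.coevaluation_evaluation]
      simp

theorem exactPairing_triangle_right (X Y Z : C) [ExactPairing X Y] :
    ((ρ_ Z).inv ≫ Z ◁ η_ X Y ≫ (α_ Z X Y).inv) ▷ X ≫ (α_ (Z ⊗ X) Y X).hom ≫
      (Z ⊗ X) ◁ ε_ X Y ≫ (ρ_ _).hom = 𝟙 (Z ⊗ X) := by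
  calc _ = Z ◁ (λ_ X).inv ≫ Z ◁ (η_ X Y ▷ X ≫ (α_ _ _ _).hom ≫ X ◁ ε_ X Y) ≫
        Z ◁ (ρ_ X).hom := by monoidal
    _ = _ := by
      rw [ExactPairing.evaluation_coevaluation]
      simp

/-- A left fusion operator is invertible when the acted object has a dual with a compatible
action; the inverse is the mate of the fusion operator of the dual. -/
theorem IsLinearPairing.isIso_fusionLeft {X Y : C} [ExactPairing X Y] {a : F.obj X ⟶ X}
    {b : F.obj Y ⟶ Y} (h : IsLinearPairing F a b) (Z : C) : IsIso (fusionLeft F b Z) := by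
  refine ⟨Y ◁ F.map ((λ_ Z).inv ≫ η_ X Y ▷ Z ≫ (α_ X Y Z).hom) ≫ Y ◁ fusionLeft F a (Y ⊗ Z) ≫
    (α_ _ _ _).inv ≫ ε_ X Y ▷ F.obj (Y ⊗ Z) ≫ (λ_ _).hom, ?_, ?_⟩
  · rw [← reassoc_of% @fusionLeft_naturality]
    have h1 : fusionLeft F b (X ⊗ Y ⊗ Z) ≫ Y ◁ fusionLeft F a (Y ⊗ Z) ≫ (α_ _ _ _).inv =
        F.map (α_ _ _ _).inv ≫ fusionLeft F (tensorAct F b a) (Y ⊗ Z) := by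
      rw [fusionLeft_tensorAct, ← F.map_comp_assoc, Iso.inv_hom_id, F.map_id, Category.id_comp]
    rw [reassoc_of% h1, ← reassoc_of% h.evaluation.fusionLeft_comm, fusionLeft_unit, ← F.map_comp,
      ← F.map_comp, ← F.map_comp, exactPairing_triangle_left, F.map_id]
  · have h1 : fusionLeft F a (Y ⊗ Z) ≫ X ◁ fusionLeft F b Z =
        F.map (α_ _ _ _).inv ≫ fusionLeft F (tensorAct F a b) Z ≫ (α_ _ _ _).hom := by
      simp [fusionLeft_tensorAct]
    have h2 : F.map (λ_ Z).inv ≫ fusionLeft F (η F) Z = (λ_ _).inv := by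
      rw [← cancel_mono (λ_ _).hom, Category.assoc, fusionLeft_unit, ← F.map_comp]
      simp
    have h3 : ε_ X Y ▷ F.obj (Y ⊗ Z) ≫ (λ_ _).hom ≫ fusionLeft F b Z =
        (Y ⊗ X) ◁ fusionLeft F b Z ≫ ε_ X Y ▷ _ ≫ (λ_ _).hom := by
      rw [← leftUnitor_naturality, whisker_exchange_assoc]
    calc _ = Y ◁ (F.map ((λ_ Z).inv ≫ η_ X Y ▷ Z ≫ (α_ X Y Z).hom) ≫ fusionLeft F a (Y ⊗ Z) ≫
            X ◁ fusionLeft F b Z) ≫ (α_ _ _ _).inv ≫ ε_ X Y ▷ _ ≫ (λ_ _).hom := by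
          simp only [Category.assoc, whiskerLeft_comp, h3, associator_inv_naturality_right_assoc]
      _ = Y ◁ ((λ_ _).inv ≫ η_ X Y ▷ _ ≫ (α_ _ _ _).hom) ≫ (α_ _ _ _).inv ≫
            ε_ X Y ▷ _ ≫ (λ_ _).hom := by
          rw [h1, F.map_comp, F.map_comp]
          simp only [Category.assoc]
          rw [← F.map_comp_assoc (α_ _ _ _).hom, Iso.hom_inv_id, F.map_id, Category.id_comp,
            reassoc_of% h.coevaluation.fusionLeft_comm, reassoc_of% h2]
      _ = _ := exactPairing_triangle_left _ _ _

/-- A right fusion operator is invertible when the acted object has a dual with a compatible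
action; the inverse is the mate of the fusion operator of the dual. -/
theorem IsLinearPairing.isIso_fusionRight {X Y : C} [ExactPairing X Y] {a : F.obj X ⟶ X}
    {b : F.obj Y ⟶ Y} (h : IsLinearPairing F a b) (Z : C) : IsIso (fusionRight F a Z) := by
  refine ⟨F.map ((ρ_ Z).inv ≫ Z ◁ η_ X Y ≫ (α_ Z X Y).inv) ▷ X ≫ fusionRight F b (Z ⊗ X) ▷ X ≫
    (α_ _ _ _).hom ≫ F.obj (Z ⊗ X) ◁ ε_ X Y ≫ (ρ_ _).hom, ?_, ?_⟩
  · rw [← reassoc_of% @fusionRight_naturality]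
    have h1 : fusionRight F a ((Z ⊗ X) ⊗ Y) ≫ fusionRight F b (Z ⊗ X) ▷ X ≫ (α_ _ _ _).hom =
        F.map (α_ _ _ _).hom ≫ fusionRight F (tensorAct F b a) (Z ⊗ X) := by
      rw [fusionRight_tensorAct, ← F.map_comp_assoc, Iso.hom_inv_id, F.map_id, Category.id_comp]
    rw [reassoc_of% h1, ← reassoc_of% h.evaluation.fusionRight_comm, fusionRight_unit, ← F.map_comp,
      ← F.map_comp, ← F.map_comp, exactPairing_triangle_right, F.map_id]
  · have h1 : fusionRight F b (Z ⊗ X) ≫ fusionRight F a Z ▷ Y =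
        F.map (α_ _ _ _).hom ≫ fusionRight F (tensorAct F a b) Z ≫ (α_ _ _ _).inv := by
      simp [fusionRight_tensorAct]
    have h2 : F.map (ρ_ Z).inv ≫ fusionRight F (η F) Z = (ρ_ _).inv := by
      rw [← cancel_mono (ρ_ _).hom, Category.assoc, fusionRight_unit, ← F.map_comp]
      simp
    have h3 : F.obj (Z ⊗ X) ◁ ε_ X Y ≫ (ρ_ _).hom ≫ fusionRight F a Z =
        fusionRight F a Z ▷ (Y ⊗ X) ≫ _ ◁ ε_ X Y ≫ (ρ_ _).hom := by
      rw [← rightUnitor_naturality, ← whisker_exchange_assoc]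
    calc _ = (F.map ((ρ_ Z).inv ≫ Z ◁ η_ X Y ≫ (α_ Z X Y).inv) ≫ fusionRight F b (Z ⊗ X) ≫
            fusionRight F a Z ▷ Y) ▷ X ≫ (α_ _ _ _).hom ≫ _ ◁ ε_ X Y ≫ (ρ_ _).hom := by
          simp only [Category.assoc, comp_whiskerRight, h3, associator_naturality_left_assoc]
      _ = ((ρ_ _).inv ≫ _ ◁ η_ X Y ≫ (α_ _ _ _).inv) ▷ X ≫ (α_ _ _ _).hom ≫
            _ ◁ ε_ X Y ≫ (ρ_ _).hom := by
          rw [h1, F.map_comp, F.map_comp]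
          simp only [Category.assoc]
          rw [← F.map_comp_assoc (α_ _ _ _).inv, Iso.inv_hom_id, F.map_id, Category.id_comp,
            reassoc_of% h.coevaluation.fusionRight_comm, reassoc_of% h2]
      _ = _ := exactPairing_triangle_right _ _ _

end Actions

/-! ### Duals of modules over a Hopf monad -/

section DualModules

variable {C : Type u} [Category.{v} C] {T : Monad C}

section Linear

variable {M N : C} {a : T.obj M ⟶ M} {b : T.obj N ⟶ N}

/-- A linear morphism is linear for the actions of `T ∘ T` obtained by acting twice. -/
theorem IsLinear.map_comp {f : M ⟶ N} (h : IsLinear (F := T.toFunctor) a b f) :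
    IsLinear (F := T.toFunctor ⋙ T.toFunctor) (T.map a ≫ a) (T.map b ≫ b) f := by
  unfold IsLinear at *
  simp only [Functor.comp_map, Category.assoc]
  rw [← T.map_comp_assoc, h, T.map_comp_assoc, h]

/-- A linear morphism is linear for the actions of `T ∘ T` obtained through the multiplication. -/
theorem IsLinear.mu_comp {f : M ⟶ N} (h : IsLinear (F := T.toFunctor) a b f) :
    IsLinear (F := T.toFunctor ⋙ T.toFunctor) (T.μ.app M ≫ a) (T.μ.app N ≫ b) f := by
  unfold IsLinear at *
  rw [Category.assoc, ← h]
  exact T.μ.naturality_assoc f b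

/-- A linear morphism is linear for the actions of the identity functor obtained through
the unit. -/
theorem IsLinear.eta_comp {f : M ⟶ N} (h : IsLinear (F := T.toFunctor) a b f) :
    IsLinear (F := 𝟭 C) (T.η.app M ≫ a) (T.η.app N ≫ b) f := by
  unfold IsLinear at *
  rw [Category.assoc, ← h]
  exact T.η.naturality_assoc f b

/-- The extension of `i : E ⟶ M` to the free module `T E` is linear. -/
theorem isLinear_map_act (M : T.Algebra) {E : C} (i : E ⟶ M.A) :
    IsLinear (F := T.toFunctor) (T.μ.app E) M.a (T.map i ≫ M.a) := by
  have h := T.μ.naturality i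
  dsimp only [Functor.comp_obj, Functor.comp_map] at h
  rw [IsLinear, T.map_comp, Category.assoc, ← M.assoc, reassoc_of% h]

end Linear

variable [MonoidalCategory C] [T.toFunctor.OplaxMonoidal]

section Transport

variable {M N : C}

theorem tensorAct_map_comp (a : T.obj M ⟶ M) (b : T.obj N ⟶ N) :
    tensorAct (T.toFunctor ⋙ T.toFunctor) (T.map a ≫ a) (T.map b ≫ b) =
      T.map (tensorAct T.toFunctor a b) ≫ tensorAct T.toFunctor a b := by
  simp [tensorAct, ← δ_natural_assoc]

theorem tensorAct_mu_comp [IsBimonad T] (a : T.obj M ⟶ M) (b : T.obj N ⟶ N) :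
    tensorAct (T.toFunctor ⋙ T.toFunctor) (T.μ.app M ≫ a) (T.μ.app N ≫ b) =
      T.μ.app (M ⊗ N) ≫ tensorAct T.toFunctor a b := by
  simp [tensorAct, reassoc_of% IsBimonad.mul_tensor (T := T)]

theorem tensorAct_eta_comp [IsBimonad T] (a : T.obj M ⟶ M) (b : T.obj N ⟶ N) :
    tensorAct (𝟭 C) (T.η.app M ≫ a) (T.η.app N ≫ b) =
      T.η.app (M ⊗ N) ≫ tensorAct T.toFunctor a b := by
  simp [tensorAct, reassoc_of% IsBimonad.unit_tensor (T := T)]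

end Transport

namespace IsLinearPairing

variable {X Y : C} [ExactPairing X Y] {a : T.obj X ⟶ X} {b : T.obj Y ⟶ Y}

theorem map_comp (h : IsLinearPairing T.toFunctor a b) :
    IsLinearPairing (T.toFunctor ⋙ T.toFunctor) (T.map a ≫ a) (T.map b ≫ b) where
  evaluation := by
    rw [tensorAct_map_comp, comp_η]
    exact h.evaluation.map_comp
  coevaluation := by
    rw [tensorAct_map_comp, comp_η]
    exact h.coevaluation.map_comp

variable [IsBimonad T]

theorem mu_comp (h : IsLinearPairing T.toFunctor a b) :
    IsLinearPairing (T.toFunctor ⋙ T.toFunctor) (T.μ.app X ≫ a) (T.μ.app Y ≫ b) where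
  evaluation := by
    rw [tensorAct_mu_comp, comp_η, ← IsBimonad.mul_counit]
    exact h.evaluation.mu_comp
  coevaluation := by
    rw [tensorAct_mu_comp, comp_η, ← IsBimonad.mul_counit]
    exact h.coevaluation.mu_comp

theorem eta_comp (h : IsLinearPairing T.toFunctor a b) :
    IsLinearPairing (𝟭 C) (T.η.app X ≫ a) (T.η.app Y ≫ b) where
  evaluation := by
    have := h.evaluation.eta_comp
    rwa [IsBimonad.unit_counit, ← tensorAct_eta_comp] at this
  coevaluation := by
    have := h.coevaluation.eta_comp
    rwa [IsBimonad.unit_counit, ← tensorAct_eta_comp] at this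

omit [T.toFunctor.OplaxMonoidal] [IsBimonad T] in
variable (X Y) in
theorem id : IsLinearPairing (𝟭 C) (𝟙 X) (𝟙 Y) where
  evaluation := by simp [IsLinear, tensorAct]
  coevaluation := by simp [IsLinear, tensorAct]

/-- The module axioms transfer to the dual: both sides of each axiom are actions compatible with the
same pairing, so they agree by `eq_of_isLinear_pairing_right`. -/
theorem unit_right (h : IsLinearPairing T.toFunctor a b) (ha : T.η.app X ≫ a = 𝟙 X) :
    T.η.app Y ≫ b = 𝟙 Y := by
  have h' := h.eta_comp
  rw [ha] at h'
  exact eq_of_isLinear_pairing_right h'.coevaluation (id X Y).evaluation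

theorem assoc_right (h : IsLinearPairing T.toFunctor a b)
    (ha : T.μ.app X ≫ a = T.map a ≫ a) : T.μ.app Y ≫ b = T.map b ≫ b := by
  have h' := h.mu_comp
  rw [ha] at h'
  exact eq_of_isLinear_pairing_right h'.coevaluation h.map_comp.evaluation

theorem unit_left (h : IsLinearPairing T.toFunctor a b) (hb : T.η.app Y ≫ b = 𝟙 Y) :
    T.η.app X ≫ a = 𝟙 X := by
  have h' := h.eta_comp
  rw [hb] at h'
  exact eq_of_isLinear_pairing_left h'.coevaluation (id X Y).evaluation

theorem assoc_left (h : IsLinearPairing T.toFunctor a b)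
    (hb : T.μ.app Y ≫ b = T.map b ≫ b) : T.μ.app X ≫ a = T.map a ≫ a := by
  have h' := h.mu_comp
  rw [hb] at h'
  exact eq_of_isLinear_pairing_left h'.coevaluation h.map_comp.evaluation

end IsLinearPairing

variable [RigidCategory C]

/-- A right antipode makes the evaluation and the coevaluation of the right dual of a module
linear, for the action `T (ᘁN) ⟶ T (ᘁ(T N)) ⟶ ᘁN` on the dual. -/
theorem RightAntipode.isLinearPairing (s : RightAntipode T) (N : T.Algebra) :
    IsLinearPairing T.toFunctor (X := (ᘁN.A : C)) (Y := N.A)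
      (T.map (ᘁN.a) ≫ s.app N.A) N.a where
  evaluation := by
    have h1 : N.a ▷ (ᘁN.A : C) ≫ ε_ (ᘁN.A : C) N.A =
        T.obj N.A ◁ (ᘁN.a) ≫ ε_ (ᘁ(T.obj N.A) : C) (T.obj N.A) :=
      (leftAdjointMate_comp_evaluation N.a).symm
    have h2 : (T.map (ᘁN.a) ≫ s.app N.A) ≫ (ᘁN.a) =
        T.map (ᘁN.a) ≫ T.map (ᘁ(T.μ.app N.A)) ≫ s.app (T.obj N.A) := by
      rw [Category.assoc, ← s.naturality, ← T.map_comp_assoc, ← T.map_comp_assoc,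
        ← comp_leftAdjointMate, ← comp_leftAdjointMate, N.assoc]
    have h3 : N.A ◁ (ᘁN.a) ≫ N.A ◁ (ᘁ(T.η.app N.A)) = 𝟙 _ := by
      rw [← whiskerLeft_comp, ← comp_leftAdjointMate, N.unit]
      simp
    unfold IsLinear tensorAct
    rw [Category.assoc, MonoidalCategory.tensorHom_def', Category.assoc, h1,
      ← whiskerLeft_comp_assoc, h2, whiskerLeft_comp_assoc, δ_natural_right_assoc,
      ← s.evaluation, ← T.map_comp_assoc, reassoc_of% h3]
  coevaluation := by
    unfold IsLinear tensorAct
    have h1 : (T.map (ᘁN.a) ≫ s.app N.A ⊗ₘ N.a) =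
        (T.map (ᘁN.a)) ▷ T.obj N.A ≫ (s.app N.A ⊗ₘ N.a) := by
      rw [MonoidalCategory.tensorHom_def, MonoidalCategory.tensorHom_def, comp_whiskerRight_assoc]
    have h2 : (s.app N.A ⊗ₘ T.μ.app N.A) ≫ (ᘁN.A : C) ◁ N.a =
        T.obj (ᘁ(T.obj N.A) : C) ◁ T.map N.a ≫ (s.app N.A ⊗ₘ N.a) := by
      rw [MonoidalCategory.tensorHom_def, MonoidalCategory.tensorHom_def, Category.assoc,
        ← whiskerLeft_comp, N.assoc, whiskerLeft_comp, ← whisker_exchange_assoc]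
    have h4 : (ᘁN.A : C) ◁ T.η.app N.A ≫ (ᘁN.A : C) ◁ N.a = 𝟙 _ := by
      rw [← whiskerLeft_comp, N.unit]
      exact whiskerLeft_id _ _
    have h3 := s.coevaluation N.A =≫ (ᘁN.A : C) ◁ N.a
    simp only [Category.assoc] at h3
    rw [h2, δ_natural_right_assoc, ← T.map_comp_assoc, h4] at h3
    erw [Category.comp_id] at h3
    rw [← coevaluation_comp_leftAdjointMate] at h3
    rw [h1, δ_natural_left_assoc, ← T.map_comp_assoc, h3]

/-- A left antipode makes the evaluation and the coevaluation of the left dual of a module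
linear, for the action `T (Nᘁ) ⟶ T ((T N)ᘁ) ⟶ Nᘁ` on the dual. -/
theorem LeftAntipode.isLinearPairing (s : LeftAntipode T) (N : T.Algebra) :
    IsLinearPairing T.toFunctor (X := N.A) (Y := N.Aᘁ) N.a (T.map (N.aᘁ) ≫ s.app N.A) where
  evaluation := by
    have h1 : N.Aᘁ ◁ N.a ≫ ε_ N.A (N.Aᘁ) =
        N.aᘁ ▷ T.obj N.A ≫ ε_ (T.obj N.A) ((T.obj N.A)ᘁ) :=
      (rightAdjointMate_comp_evaluation N.a).symm
    have h2 : (T.map (N.aᘁ) ≫ s.app N.A) ≫ N.aᘁ =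
        T.map (N.aᘁ) ≫ T.map ((T.μ.app N.A)ᘁ) ≫ s.app (T.obj N.A) := by
      rw [Category.assoc, ← s.naturality, ← T.map_comp_assoc, ← T.map_comp_assoc,
        ← comp_rightAdjointMate, ← comp_rightAdjointMate, N.assoc]
    have h3 : N.aᘁ ▷ N.A ≫ (T.η.app N.A)ᘁ ▷ N.A = 𝟙 _ := by
      rw [← comp_whiskerRight, ← comp_rightAdjointMate, N.unit]
      simp
    unfold IsLinear tensorAct
    rw [Category.assoc, MonoidalCategory.tensorHom_def, Category.assoc, h1,
      ← comp_whiskerRight_assoc, h2, comp_whiskerRight_assoc, δ_natural_left_assoc,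
      ← s.evaluation, ← T.map_comp_assoc, reassoc_of% h3]
  coevaluation := by
    unfold IsLinear tensorAct
    have h1 : (N.a ⊗ₘ T.map (N.aᘁ) ≫ s.app N.A) =
        T.obj N.A ◁ T.map (N.aᘁ) ≫ (N.a ⊗ₘ s.app N.A) := by
      rw [MonoidalCategory.tensorHom_def', MonoidalCategory.tensorHom_def', whiskerLeft_comp_assoc]
    have h2 : (T.μ.app N.A ⊗ₘ s.app N.A) ≫ N.a ▷ N.Aᘁ =
        T.map N.a ▷ T.obj ((T.obj N.A)ᘁ) ≫ (N.a ⊗ₘ s.app N.A) := by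
      rw [MonoidalCategory.tensorHom_def', MonoidalCategory.tensorHom_def', Category.assoc,
        ← comp_whiskerRight, N.assoc, comp_whiskerRight, whisker_exchange_assoc]
    have h4 : T.η.app N.A ▷ N.Aᘁ ≫ N.a ▷ N.Aᘁ = 𝟙 _ := by
      rw [← comp_whiskerRight, N.unit]
      exact id_whiskerRight _ _
    have h3 := s.coevaluation N.A =≫ N.a ▷ N.Aᘁ
    simp only [Category.assoc] at h3
    rw [h2, δ_natural_left_assoc, ← T.map_comp_assoc, h4] at h3
    erw [Category.comp_id] at h3
    rw [← coevaluation_comp_rightAdjointMate] at h3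
    rw [h1, δ_natural_right_assoc, ← T.map_comp_assoc, h3]

variable [IsBimonad T]

/-- The right dual of a module over a monad with a right antipode. -/
def RightAntipode.dualAlgebra (s : RightAntipode T) (N : T.Algebra) : T.Algebra where
  A := (ᘁN.A : C)
  a := T.map (ᘁN.a) ≫ s.app N.A
  unit := (s.isLinearPairing N).unit_left N.unit
  assoc := (s.isLinearPairing N).assoc_left N.assoc

/-- The left dual of a module over a monad with a left antipode. -/
def LeftAntipode.dualAlgebra (s : LeftAntipode T) (N : T.Algebra) : T.Algebra where
  A := N.Aᘁ
  a := T.map (N.aᘁ) ≫ s.app N.A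
  unit := (s.isLinearPairing N).unit_right N.unit
  assoc := (s.isLinearPairing N).assoc_right N.assoc

end DualModules

/-! ### Coinvariants of Hopf modules -/

section Equalizers

variable {C : Type u} [Category.{v} C]

/-- The morphism `i` is an equalizer of `f` and `g`. -/
structure IsEqualizer {A B E : C} (f g : A ⟶ B) (i : E ⟶ A) : Prop where
  condition : i ≫ f = i ≫ g
  existsUnique_lift {W : C} (k : W ⟶ A) : k ≫ f = k ≫ g → ∃! h : W ⟶ E, h ≫ i = k

theorem IsEqualizer.of_isLimit {A B E : C} {f g : A ⟶ B} {i : E ⟶ A} {w : i ≫ f = i ≫ g}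
    (h : IsLimit (Fork.ofι i w)) : IsEqualizer f g i where
  condition := w
  existsUnique_lift k hk := Fork.IsLimit.existsUnique h k hk

theorem IsEqualizer.hom_ext {A B E W : C} {f g : A ⟶ B} {i : E ⟶ A} (h : IsEqualizer f g i)
    {k l : W ⟶ E} (e : k ≫ i = l ≫ i) : k = l :=
  (h.existsUnique_lift (l ≫ i) (by simp [h.condition])).unique e rfl

/-- The morphism `i` is an equalizer of `f` and `g`, and the functor `F` preserves it. -/
structure IsPreservedEqualizer (F : C ⥤ C) {A B E : C} (f g : A ⟶ B) (i : E ⟶ A) : Prop where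
  isEqualizer : IsEqualizer f g i
  map : IsEqualizer (F.map f) (F.map g) (F.map i)

theorem exists_isPreservedEqualizer (F : C ⥤ C) {A B : C} (f g : A ⟶ B) (h : HasEqualizer f g)
    (hF : PreservesLimit (parallelPair f g) F) :
    ∃ (E : C) (i : E ⟶ A), IsPreservedEqualizer F f g i :=
  ⟨equalizer f g, equalizer.ι f g, .of_isLimit (equalizerIsEqualizer f g),
    .of_isLimit (isLimitOfHasEqualizerOfPreservesLimit F f g)⟩

end Equalizers

section FreeCoactions

variable {C : Type u} [Category.{v} C] [MonoidalCategory C] (T : Monad C)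
  [T.toFunctor.OplaxMonoidal]

/-- The right coaction of `T 𝟙` on `T X`. -/
def freeRightCoact (X : C) : T.obj X ⟶ T.obj X ⊗ T.obj (𝟙_ C) :=
  T.map (ρ_ X).inv ≫ δ T.toFunctor X (𝟙_ C)

/-- The left coaction of `T 𝟙` on `T X`. -/
def freeLeftCoact (X : C) : T.obj X ⟶ T.obj (𝟙_ C) ⊗ T.obj X :=
  T.map (λ_ X).inv ≫ δ T.toFunctor (𝟙_ C) X

variable {T}

theorem freeRightCoact_naturality {X Y : C} (f : X ⟶ Y) :
    T.map f ≫ freeRightCoact T Y = freeRightCoact T X ≫ T.map f ▷ T.obj (𝟙_ C) := by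
  simp only [freeRightCoact, Category.assoc, δ_natural_left]
  rw [← T.map_comp_assoc, ← T.map_comp_assoc, rightUnitor_inv_naturality]

theorem freeLeftCoact_naturality {X Y : C} (f : X ⟶ Y) :
    T.map f ≫ freeLeftCoact T Y = freeLeftCoact T X ≫ T.obj (𝟙_ C) ◁ T.map f := by
  simp only [freeLeftCoact, Category.assoc, δ_natural_right]
  rw [← T.map_comp_assoc, ← T.map_comp_assoc, leftUnitor_inv_naturality]

variable (T) in
/-- The morphism `T M ⟶ M ⊗ T 𝟙` attached to an action `a` on `M`. For a Hopf monad it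
identifies the free module on `M` with `M ⊗ T 𝟙`. -/
def rightFusion {M : C} (a : T.obj M ⟶ M) : T.obj M ⟶ M ⊗ T.obj (𝟙_ C) :=
  freeRightCoact T M ≫ a ▷ T.obj (𝟙_ C)

variable (T) in
/-- The morphism `T M ⟶ T 𝟙 ⊗ M` attached to an action `a` on `M`. For a Hopf monad it
identifies the free module on `M` with `T 𝟙 ⊗ M`. -/
def leftFusion {M : C} (a : T.obj M ⟶ M) : T.obj M ⟶ T.obj (𝟙_ C) ⊗ M :=
  freeLeftCoact T M ≫ T.obj (𝟙_ C) ◁ a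

theorem rightFusion_eq {M : C} (a : T.obj M ⟶ M) :
    rightFusion T a = T.map (ρ_ M).inv ≫ fusionLeft T.toFunctor a (𝟙_ C) := by
  simp [rightFusion, freeRightCoact, fusionLeft]

theorem leftFusion_eq {M : C} (a : T.obj M ⟶ M) :
    leftFusion T a = T.map (λ_ M).inv ≫ fusionRight T.toFunctor a (𝟙_ C) := by
  simp [leftFusion, freeLeftCoact, fusionRight]

theorem rightFusion_counit {M : C} (a : T.obj M ⟶ M) :
    rightFusion T a ≫ M ◁ η T.toFunctor = a ≫ (ρ_ M).inv := by
  have h := oplax_right_unitality T.toFunctor M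
  rw [rightFusion, freeRightCoact, Category.assoc, ← whisker_exchange, Category.assoc,
    ← reassoc_of% h, rightUnitor_inv_naturality]

theorem leftFusion_counit {M : C} (a : T.obj M ⟶ M) :
    leftFusion T a ≫ η T.toFunctor ▷ M = a ≫ (λ_ M).inv := by
  have h := oplax_left_unitality T.toFunctor M
  rw [leftFusion, freeLeftCoact, Category.assoc, whisker_exchange, Category.assoc,
    ← reassoc_of% h, leftUnitor_inv_naturality]

theorem rightFusion_mu : T.map (T.η.app (𝟙_ C)) ≫ rightFusion T (T.μ.app (𝟙_ C)) = comul T := by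
  rw [rightFusion, reassoc_of% @freeRightCoact_naturality, ← comp_whiskerRight, T.right_unit,
    freeRightCoact, comul, unitors_inv_equal]
  simp

theorem leftFusion_mu : T.map (T.η.app (𝟙_ C)) ≫ leftFusion T (T.μ.app (𝟙_ C)) = comul T := by
  rw [leftFusion, reassoc_of% @freeLeftCoact_naturality, ← whiskerLeft_comp, T.right_unit,
    freeLeftCoact, comul]
  simp

theorem IsLinear.rightFusion_comm {M N : C} {a : T.obj M ⟶ M} {b : T.obj N ⟶ N} {f : M ⟶ N}
    (h : IsLinear (F := T.toFunctor) a b f) :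
    T.map f ≫ rightFusion T b = rightFusion T a ≫ f ▷ T.obj (𝟙_ C) := by
  unfold IsLinear at h
  rw [rightFusion, reassoc_of% @freeRightCoact_naturality, ← comp_whiskerRight, h,
    comp_whiskerRight, rightFusion, Category.assoc]

theorem IsLinear.leftFusion_comm {M N : C} {a : T.obj M ⟶ M} {b : T.obj N ⟶ N} {f : M ⟶ N}
    (h : IsLinear (F := T.toFunctor) a b f) :
    T.map f ≫ leftFusion T b = leftFusion T a ≫ T.obj (𝟙_ C) ◁ f := by
  unfold IsLinear at h
  rw [leftFusion, reassoc_of% @freeLeftCoact_naturality, ← whiskerLeft_comp, h, whiskerLeft_comp,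
    leftFusion, Category.assoc]

theorem rightFusion_tensorAct {M N : C} (a : T.obj M ⟶ M) (b : T.obj N ⟶ N) :
    rightFusion T (tensorAct T.toFunctor a b) ≫ (α_ _ _ _).hom =
      fusionLeft T.toFunctor a N ≫ M ◁ rightFusion T b := by
  rw [rightFusion_eq, rightFusion_eq, fusionLeft_tensorAct, whiskerLeft_comp,
    ← reassoc_of% @fusionLeft_naturality, ← T.map_comp_assoc]
  simp

theorem leftFusion_tensorAct {M N : C} (a : T.obj M ⟶ M) (b : T.obj N ⟶ N) :
    leftFusion T (tensorAct T.toFunctor a b) ≫ (α_ _ _ _).inv =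
      fusionRight T.toFunctor b M ≫ leftFusion T a ▷ N := by
  rw [leftFusion_eq, leftFusion_eq, fusionRight_tensorAct, comp_whiskerRight,
    ← reassoc_of% @fusionRight_naturality, ← T.map_comp_assoc]
  simp

end FreeCoactions

/-! ### The fundamental theorem of Hopf modules -/

section FundamentalTheorem

variable {C : Type u} [Category.{v} C] [MonoidalCategory C] [RigidCategory C] {T : Monad C}
  [T.toFunctor.OplaxMonoidal]

theorem RightAntipode.isIso_rightFusion (s : RightAntipode T) (N : T.Algebra) :
    IsIso (rightFusion T N.a) := by
  have := (s.isLinearPairing N).isIso_fusionLeft (𝟙_ C)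
  rw [rightFusion_eq]
  infer_instance

theorem LeftAntipode.isIso_leftFusion (s : LeftAntipode T) (N : T.Algebra) :
    IsIso (leftFusion T N.a) := by
  have := (s.isLinearPairing N).isIso_fusionRight (𝟙_ C)
  rw [leftFusion_eq]
  infer_instance

section

omit [RigidCategory C]

theorem RightHopfModule.isLinear_coact (M : RightHopfModule T) :
    IsLinear (F := T.toFunctor) M.a (tensorAct T.toFunctor M.a (T.μ.app (𝟙_ C))) M.coact :=
  M.act_coact.symm

theorem LeftHopfModule.isLinear_coact (M : LeftHopfModule T) :
    IsLinear (F := T.toFunctor) M.a (tensorAct T.toFunctor (T.μ.app (𝟙_ C)) M.a) M.coact :=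
  M.act_coact.symm

/-- The linear extension of a coinvariant morphism is a morphism of comodules. -/
theorem RightHopfModule.map_act_coact (M : RightHopfModule T) {E : C} {i : E ⟶ M.A}
    (h : i ≫ M.coact = i ≫ rightTrivialCoaction T M.A) :
    (T.map i ≫ M.a) ≫ M.coact = T.map i ≫ rightFusion T M.a := by
  have hu : T.map (T.η.app (𝟙_ C)) ≫ T.μ.app (𝟙_ C) = 𝟙 (T.obj (𝟙_ C)) := T.right_unit _
  have h1 : T.map (rightTrivialCoaction T M.A) ≫
      tensorAct T.toFunctor M.a (T.μ.app (𝟙_ C)) = rightFusion T M.a := by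
    rw [rightTrivialCoaction, T.map_comp, tensorAct, Category.assoc, ← δ_natural_right_assoc,
      MonoidalCategory.tensorHom_def', ← whiskerLeft_comp_assoc, hu, whiskerLeft_id,
      Category.id_comp, rightFusion, freeRightCoact, Category.assoc]
  rw [Category.assoc, ← M.isLinear_coact, ← T.map_comp_assoc, h, T.map_comp_assoc, h1]

/-- The linear extension of a coinvariant morphism is a morphism of comodules. -/
theorem LeftHopfModule.map_act_coact (M : LeftHopfModule T) {E : C} {i : E ⟶ M.A}
    (h : i ≫ M.coact = i ≫ leftTrivialCoaction T M.A) :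
    (T.map i ≫ M.a) ≫ M.coact = T.map i ≫ leftFusion T M.a := by
  have hu : T.map (T.η.app (𝟙_ C)) ≫ T.μ.app (𝟙_ C) = 𝟙 (T.obj (𝟙_ C)) := T.right_unit _
  have h1 : T.map (leftTrivialCoaction T M.A) ≫
      tensorAct T.toFunctor (T.μ.app (𝟙_ C)) M.a = leftFusion T M.a := by
    rw [leftTrivialCoaction, T.map_comp, tensorAct, Category.assoc, ← δ_natural_left_assoc,
      MonoidalCategory.tensorHom_def, ← comp_whiskerRight_assoc, hu, leftFusion,
      freeLeftCoact, Category.assoc]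
    erw [id_whiskerRight, Category.id_comp]
    rfl
  rw [Category.assoc, ← M.isLinear_coact, ← T.map_comp_assoc, h, T.map_comp_assoc, h1]

end

/-- The fundamental theorem for right Hopf modules. The fusion isomorphism `T M ≅ M ⊗ T 𝟙`
carries the pair whose equalizer is `T E` to the pair `ρ ⊗ id, id ⊗ Δ`, of which the coaction `ρ`
is an equalizer. -/
theorem RightHopfModule.isIso_map_act (s : RightAntipode T) (M : RightHopfModule T) {E : C}
    {i : E ⟶ M.A} (h : IsPreservedEqualizer T.toFunctor M.coact (rightTrivialCoaction T M.A) i) :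
    IsIso (T.map i ≫ M.a) := by
  have := s.isIso_rightFusion M.toAlgebra
  have := s.isIso_rightFusion (T.free.obj (𝟙_ C))
  have := (s.isLinearPairing M.toAlgebra).isIso_fusionLeft (T.obj (𝟙_ C))
  have hc : T.map M.coact ≫ fusionLeft T.toFunctor M.a (T.obj (𝟙_ C)) ≫
      M.A ◁ rightFusion T (T.μ.app (𝟙_ C)) =
        rightFusion T M.a ≫ M.coact ▷ T.obj (𝟙_ C) ≫ (α_ _ _ _).hom := by
    rw [← rightFusion_tensorAct, ← Category.assoc, M.isLinear_coact.rightFusion_comm,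
      Category.assoc]
  have ht : T.map (rightTrivialCoaction T M.A) ≫ fusionLeft T.toFunctor M.a (T.obj (𝟙_ C)) ≫
      M.A ◁ rightFusion T (T.μ.app (𝟙_ C)) = rightFusion T M.a ≫ M.A ◁ comul T := by
    rw [rightTrivialCoaction, T.map_comp_assoc, reassoc_of% @fusionLeft_naturality,
      ← whiskerLeft_comp, rightFusion_mu, rightFusion_eq, Category.assoc]
  have hmono : Mono (fusionLeft T.toFunctor M.a (T.obj (𝟙_ C)) ≫
      M.A ◁ rightFusion T (T.μ.app (𝟙_ C))) := by
    have : IsIso (rightFusion T (T.μ.app (𝟙_ C))) := ‹IsIso (rightFusion T (T.free.obj _).a)›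
    infer_instance
  obtain ⟨k, hk, -⟩ := h.map.existsUnique_lift (M.coact ≫ inv (rightFusion T M.a)) (by
    rw [← cancel_mono (fusionLeft T.toFunctor M.a (T.obj (𝟙_ C)) ≫
      M.A ◁ rightFusion T (T.μ.app (𝟙_ C)))]
    simp only [Category.assoc, hc, ht, IsIso.inv_hom_id_assoc, M.coact_comul])
  refine ⟨k, ?_, ?_⟩
  · apply h.map.hom_ext
    rw [Category.assoc, hk, ← Category.assoc, M.map_act_coact h.isEqualizer.condition]
    simp
  · have e : inv (rightFusion T M.a) ≫ M.a = M.A ◁ η T.toFunctor ≫ (ρ_ _).hom := by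
      rw [IsIso.inv_comp_eq, reassoc_of% @rightFusion_counit]
      simp
    rw [reassoc_of% hk, e, reassoc_of% M.coact_counit, Iso.inv_hom_id]

/-- The fundamental theorem for left Hopf modules. -/
theorem LeftHopfModule.isIso_map_act (s : LeftAntipode T) (M : LeftHopfModule T) {E : C}
    {i : E ⟶ M.A} (h : IsPreservedEqualizer T.toFunctor M.coact (leftTrivialCoaction T M.A) i) :
    IsIso (T.map i ≫ M.a) := by
  have := s.isIso_leftFusion M.toAlgebra
  have := s.isIso_leftFusion (T.free.obj (𝟙_ C))
  have := (s.isLinearPairing M.toAlgebra).isIso_fusionRight (T.obj (𝟙_ C))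
  have hc : T.map M.coact ≫ fusionRight T.toFunctor M.a (T.obj (𝟙_ C)) ≫
      leftFusion T (T.μ.app (𝟙_ C)) ▷ M.A =
        leftFusion T M.a ≫ T.obj (𝟙_ C) ◁ M.coact ≫ (α_ _ _ _).inv := by
    rw [← leftFusion_tensorAct, ← Category.assoc, M.isLinear_coact.leftFusion_comm,
      Category.assoc]
  have ht : T.map (leftTrivialCoaction T M.A) ≫ fusionRight T.toFunctor M.a (T.obj (𝟙_ C)) ≫
      leftFusion T (T.μ.app (𝟙_ C)) ▷ M.A = leftFusion T M.a ≫ comul T ▷ M.A := by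
    rw [leftTrivialCoaction, T.map_comp_assoc, reassoc_of% @fusionRight_naturality,
      ← comp_whiskerRight, leftFusion_mu, leftFusion_eq, Category.assoc]
    rfl
  have hmono : Mono (fusionRight T.toFunctor M.a (T.obj (𝟙_ C)) ≫
      leftFusion T (T.μ.app (𝟙_ C)) ▷ M.A) := by
    have : IsIso (leftFusion T (T.μ.app (𝟙_ C))) := ‹IsIso (leftFusion T (T.free.obj _).a)›
    infer_instance
  obtain ⟨k, hk, -⟩ := h.map.existsUnique_lift (M.coact ≫ inv (leftFusion T M.a)) (by
    rw [← cancel_mono (fusionRight T.toFunctor M.a (T.obj (𝟙_ C)) ≫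
      leftFusion T (T.μ.app (𝟙_ C)) ▷ M.A)]
    simp only [Category.assoc, hc, ht, IsIso.inv_hom_id_assoc, reassoc_of% M.coact_comul,
      Iso.hom_inv_id, Category.comp_id])
  refine ⟨k, ?_, ?_⟩
  · apply h.map.hom_ext
    rw [Category.assoc, hk, ← Category.assoc, M.map_act_coact h.isEqualizer.condition]
    simp
  · have e : inv (leftFusion T M.a) ≫ M.a = η T.toFunctor ▷ M.A ≫ (λ_ _).hom := by
      rw [IsIso.inv_comp_eq, reassoc_of% @leftFusion_counit]
      simp
    rw [reassoc_of% hk, e, reassoc_of% M.coact_counit, Iso.inv_hom_id]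

end FundamentalTheorem

/-! ### Free Hopf modules -/

section FreeHopfModules

variable {C : Type u} [Category.{v} C] (T : Monad C)

variable {T} in
/-- Let `i : E ⟶ T X` be an equalizer of `f` and `g` which extends to an isomorphism `T E ≅ T X`.
If `T` is conservative and the unit of `X` equalizes `f` and `g`, then the unit is an equalizer as
well: the comparison `X ⟶ E` becomes invertible after applying `T`. -/
theorem isEqualizer_unit [T.toFunctor.ReflectsIsomorphisms] {X E B : C} {f g : T.obj X ⟶ B}
    {i : E ⟶ T.obj X} (h : IsEqualizer f g i) (hu : T.η.app X ≫ f = T.η.app X ≫ g)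
    (hi : IsIso (T.map i ≫ T.μ.app X)) : IsEqualizer f g (T.η.app X) := by
  obtain ⟨u, e, -⟩ := h.existsUnique_lift (T.η.app X) hu
  have hTu : T.map u ≫ T.map i ≫ T.μ.app X = 𝟙 _ := by
    rw [← T.map_comp_assoc, e]
    exact T.right_unit X
  have : IsIso (T.map u) := by
    rw [← IsIso.eq_comp_inv, Category.id_comp] at hTu
    rw [hTu]
    infer_instance
  have : IsIso u := isIso_of_reflects_iso u T.toFunctor
  refine ⟨hu, fun k hk => ?_⟩
  obtain ⟨l, hl, hl'⟩ := h.existsUnique_lift k hk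
  refine ⟨l ≫ inv u, ?_, fun y hy => ?_⟩
  · rw [← e]
    simp [hl]
  · rw [IsIso.eq_comp_inv]
    apply hl'
    rw [← hy, ← e, Category.assoc]

variable [MonoidalCategory C] [T.toFunctor.OplaxMonoidal] [IsBimonad T]

/-- The free right Hopf module on `X`. -/
def freeRightHopfModule (X : C) : RightHopfModule T where
  A := T.obj X
  a := T.μ.app X
  unit := T.left_unit X
  assoc := (T.assoc X).symm
  coact := freeRightCoact T X
  coact_counit := by
    rw [freeRightCoact, Category.assoc]
    exact (oplax_right_unitality T.toFunctor X).symm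
  coact_comul := by
    have h : (ρ_ X).inv ≫ (ρ_ X).inv ▷ 𝟙_ C ≫ (α_ X (𝟙_ C) (𝟙_ C)).hom =
        (ρ_ X).inv ≫ X ◁ (λ_ (𝟙_ C)).inv := by monoidal
    simp only [freeRightCoact, comul, comp_whiskerRight, Category.assoc, whiskerLeft_comp,
      δ_natural_left_assoc, oplax_associativity, δ_natural_right_assoc]
    simp only [← T.map_comp_assoc, h]
  act_coact := by
    have h := T.μ.naturality (ρ_ X).inv
    dsimp only [Functor.comp_obj, Functor.comp_map] at h
    rw [freeRightCoact, ← reassoc_of% h, IsBimonad.mul_tensor, T.map_comp, Category.assoc]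

/-- The free left Hopf module on `X`. -/
def freeLeftHopfModule (X : C) : LeftHopfModule T where
  A := T.obj X
  a := T.μ.app X
  unit := T.left_unit X
  assoc := (T.assoc X).symm
  coact := freeLeftCoact T X
  coact_counit := by
    rw [freeLeftCoact, Category.assoc]
    exact (oplax_left_unitality T.toFunctor X).symm
  coact_comul := by
    have h : (λ_ X).inv ≫ (𝟙_ C) ◁ (λ_ X).inv =
        (λ_ X).inv ≫ (λ_ (𝟙_ C)).inv ▷ X ≫ (α_ (𝟙_ C) (𝟙_ C) X).hom := by monoidal
    simp only [freeLeftCoact, comul, comp_whiskerRight, Category.assoc, whiskerLeft_comp,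
      δ_natural_left_assoc, oplax_associativity, δ_natural_right_assoc]
    simp only [← T.map_comp_assoc, h]
  act_coact := by
    have h := T.μ.naturality (λ_ X).inv
    dsimp only [Functor.comp_obj, Functor.comp_map] at h
    rw [freeLeftCoact, ← reassoc_of% h, IsBimonad.mul_tensor, T.map_comp, Category.assoc]

variable {T}

theorem unit_freeRightCoact (X : C) :
    T.η.app X ≫ freeRightCoact T X = T.η.app X ≫ rightTrivialCoaction T (T.obj X) := by
  have h := T.η.naturality (ρ_ X).inv
  dsimp only [Functor.id_obj, Functor.id_map] at h
  rw [freeRightCoact, ← reassoc_of% h, IsBimonad.unit_tensor, rightTrivialCoaction,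
    MonoidalCategory.tensorHom_def]
  exact (rightUnitor_inv_naturality_assoc (T.η.app X) _).symm

theorem unit_freeLeftCoact (X : C) :
    T.η.app X ≫ freeLeftCoact T X = T.η.app X ≫ leftTrivialCoaction T (T.obj X) := by
  have h := T.η.naturality (λ_ X).inv
  dsimp only [Functor.id_obj, Functor.id_map] at h
  rw [freeLeftCoact, ← reassoc_of% h, IsBimonad.unit_tensor, leftTrivialCoaction,
    MonoidalCategory.tensorHom_def']
  exact (leftUnitor_inv_naturality_assoc (T.η.app X) _).symm

variable [RigidCategory C]

/-- For a conservative Hopf monad, the coinvariants of the free right Hopf module on `X` are `X`. -/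
theorem RightAntipode.isEqualizer_unit [T.toFunctor.ReflectsIsomorphisms] (s : RightAntipode T)
    {X E : C} {i : E ⟶ T.obj X} (h : IsPreservedEqualizer T.toFunctor (freeRightCoact T X)
      (rightTrivialCoaction T (T.obj X)) i) :
    IsEqualizer (freeRightCoact T X) (rightTrivialCoaction T (T.obj X)) (T.η.app X) :=
  HopfMonad.isEqualizer_unit h.isEqualizer (unit_freeRightCoact X)
    ((freeRightHopfModule T X).isIso_map_act s h)

/-- For a conservative Hopf monad, the coinvariants of the free left Hopf module on `X` are `X`. -/
theorem LeftAntipode.isEqualizer_unit [T.toFunctor.ReflectsIsomorphisms] (s : LeftAntipode T)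
    {X E : C} {i : E ⟶ T.obj X} (h : IsPreservedEqualizer T.toFunctor (freeLeftCoact T X)
      (leftTrivialCoaction T (T.obj X)) i) :
    IsEqualizer (freeLeftCoact T X) (leftTrivialCoaction T (T.obj X)) (T.η.app X) :=
  HopfMonad.isEqualizer_unit h.isEqualizer (unit_freeLeftCoact X)
    ((freeLeftHopfModule T X).isIso_map_act s h)

end FreeHopfModules

/-! ### Duals of Hopf modules -/

section DualCoactions

variable {C : Type u} [Category.{v} C] [MonoidalCategory C]

/-- A left coaction `l` of `H` on `A` extends a pairing `A ⊗ D ⟶ 𝟙` to a morphism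
`A ⊗ D ⟶ H`. -/
def leftExtend {A D H : C} (l : A ⟶ H ⊗ A) (p : A ⊗ D ⟶ 𝟙_ C) : A ⊗ D ⟶ H :=
  l ▷ D ≫ (α_ _ _ _).hom ≫ H ◁ p ≫ (ρ_ H).hom

/-- A right coaction `r` of `H` on `D` extends a pairing `A ⊗ D ⟶ 𝟙` to a morphism
`A ⊗ D ⟶ H`. -/
def rightExtend {A D H : C} (r : D ⟶ D ⊗ H) (p : A ⊗ D ⟶ 𝟙_ C) : A ⊗ D ⟶ H :=
  A ◁ r ≫ (α_ _ _ _).inv ≫ p ▷ H ≫ (λ_ H).hom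

section

variable {A D H : C} (p : A ⊗ D ⟶ 𝟙_ C)

/-- Composing the extension with the counit recovers the pairing. -/
theorem leftExtend_counit {l : A ⟶ H ⊗ A} {e : H ⟶ 𝟙_ C} (h : l ≫ e ▷ A = (λ_ A).inv) :
    leftExtend l p ≫ e = p := by
  calc _ = l ▷ D ≫ (α_ _ _ _).hom ≫ (H ◁ p ≫ e ▷ 𝟙_ C) ≫ (ρ_ _).hom := by simp [leftExtend]
    _ = (l ≫ e ▷ A) ▷ D ≫ (α_ _ _ _).hom ≫ 𝟙_ C ◁ p ≫ (ρ_ _).hom := by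
      rw [whisker_exchange]
      simp
    _ = _ := by
      rw [h, ← unitors_equal]
      simp

theorem rightExtend_counit {r : D ⟶ D ⊗ H} {e : H ⟶ 𝟙_ C} (h : r ≫ D ◁ e = (ρ_ D).inv) :
    rightExtend r p ≫ e = p := by
  calc _ = A ◁ r ≫ (α_ _ _ _).inv ≫ (p ▷ H ≫ 𝟙_ C ◁ e) ≫ (λ_ _).hom := by simp [rightExtend]
    _ = A ◁ (r ≫ D ◁ e) ≫ (α_ _ _ _).inv ≫ p ▷ 𝟙_ C ≫ (λ_ _).hom := by
      rw [← whisker_exchange]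
      simp
    _ = _ := by
      rw [h, unitors_equal]
      simp

/-- If the coactions `l` and `r` are adjoint for the pairing `p`, then so are their iterates. -/
theorem rightExtend_iterate {l : A ⟶ H ⊗ A} {r : D ⟶ D ⊗ H}
    (h : rightExtend r p = leftExtend l p) :
    rightExtend (r ≫ r ▷ H ≫ (α_ _ _ _).hom) p =
      leftExtend (l ≫ H ◁ l ≫ (α_ _ _ _).inv) p := by
  calc _ = A ◁ r ≫ (α_ _ _ _).inv ≫ rightExtend r p ▷ H := by
        simp only [rightExtend]
        monoidal
    _ = (A ◁ r ≫ l ▷ (D ⊗ H)) ≫ (α_ _ _ _).hom ≫ H ◁ ((α_ _ _ _).inv ≫ p ▷ H ≫ (λ_ H).hom) := by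
        rw [h]
        simp only [leftExtend]
        monoidal
    _ = l ▷ D ≫ (α_ _ _ _).hom ≫ H ◁ rightExtend r p := by
        rw [whisker_exchange]
        simp only [rightExtend]
        monoidal
    _ = _ := by
        rw [h]
        simp only [leftExtend]
        monoidal

/-- Coassociativity of a coaction, expressed through the extension of a pairing. -/
theorem leftExtend_comul {l : A ⟶ H ⊗ A} {d : H ⟶ H ⊗ H}
    (h : l ≫ H ◁ l = l ≫ d ▷ A ≫ (α_ _ _ _).hom) :
    leftExtend (l ≫ H ◁ l ≫ (α_ _ _ _).inv) p = leftExtend l p ≫ d := by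
  calc _ = l ▷ D ≫ (α_ _ _ _).hom ≫ (d ▷ (A ⊗ D) ≫ (H ⊗ H) ◁ p) ≫ (ρ_ _).hom := by
        rw [reassoc_of% h]
        simp [leftExtend]
    _ = _ := by
        rw [← whisker_exchange]
        simp [leftExtend]

theorem rightExtend_comul {r : D ⟶ D ⊗ H} {d : H ⟶ H ⊗ H}
    (h : r ≫ r ▷ H ≫ (α_ _ _ _).hom = r ≫ D ◁ d) :
    rightExtend (r ≫ r ▷ H ≫ (α_ _ _ _).hom) p = rightExtend r p ≫ d := by
  calc _ = A ◁ r ≫ (α_ _ _ _).inv ≫ ((A ⊗ D) ◁ d ≫ p ▷ (H ⊗ H)) ≫ (λ_ _).hom := by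
        rw [h]
        simp [rightExtend]
    _ = _ := by
        rw [whisker_exchange]
        simp [rightExtend]

end

variable {A D H : C}

/-- The right coaction on the first member `D` of an exact pairing which is adjoint to a left
coaction on the second. -/
def dualRightCoact [ExactPairing D A] (l : A ⟶ H ⊗ A) : D ⟶ D ⊗ H :=
  tensorLeftHomEquiv D D A H (leftExtend l (ε_ D A))

/-- The left coaction on the second member `A` of an exact pairing which is adjoint to a right
coaction on the first. -/
def dualLeftCoact [ExactPairing D A] (r : D ⟶ D ⊗ H) : A ⟶ H ⊗ A :=
  tensorRightHomEquiv A D A H (rightExtend r (ε_ D A))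

section

variable [ExactPairing D A]

theorem rightExtend_evaluation (r : D ⟶ D ⊗ H) :
    rightExtend r (ε_ D A) = (tensorLeftHomEquiv D D A H).symm r := rfl

theorem leftExtend_evaluation (l : A ⟶ H ⊗ A) :
    leftExtend l (ε_ D A) = (tensorRightHomEquiv A D A H).symm l := rfl

theorem rightExtend_dualRightCoact (l : A ⟶ H ⊗ A) :
    rightExtend (dualRightCoact (D := D) l) (ε_ D A) = leftExtend l (ε_ D A) :=
  (tensorLeftHomEquiv D D A H).symm_apply_apply _

theorem leftExtend_dualLeftCoact (r : D ⟶ D ⊗ H) :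
    leftExtend (dualLeftCoact (A := A) r) (ε_ D A) = rightExtend r (ε_ D A) :=
  (tensorRightHomEquiv A D A H).symm_apply_apply _

theorem dualRightCoact_counit {l : A ⟶ H ⊗ A} {e : H ⟶ 𝟙_ C} (h : l ≫ e ▷ A = (λ_ A).inv) :
    dualRightCoact l ≫ D ◁ e = (ρ_ D).inv := by
  rw [dualRightCoact, ← tensorLeftHomEquiv_naturality, leftExtend_counit _ h,
    ← Equiv.eq_symm_apply]
  simp [tensorLeftHomEquiv, unitors_equal]

theorem dualLeftCoact_counit {r : D ⟶ D ⊗ H} {e : H ⟶ 𝟙_ C} (h : r ≫ D ◁ e = (ρ_ D).inv) :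
    dualLeftCoact r ≫ e ▷ A = (λ_ A).inv := by
  rw [dualLeftCoact, ← tensorRightHomEquiv_naturality, rightExtend_counit _ h,
    ← Equiv.eq_symm_apply]
  simp [tensorRightHomEquiv, ← unitors_equal]

theorem dualRightCoact_comul {l : A ⟶ H ⊗ A} {d : H ⟶ H ⊗ H}
    (h : l ≫ H ◁ l = l ≫ d ▷ A ≫ (α_ _ _ _).hom) :
    dualRightCoact l ≫ dualRightCoact l ▷ H ≫ (α_ _ _ _).hom =
      dualRightCoact l ≫ D ◁ d := by
  have h1 := rightExtend_iterate (ε_ D A) (rightExtend_dualRightCoact (D := D) l)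
  rw [leftExtend_comul _ h, rightExtend_evaluation] at h1
  rw [Equiv.symm_apply_eq] at h1
  rw [h1, tensorLeftHomEquiv_naturality]
  rfl

theorem dualLeftCoact_comul {r : D ⟶ D ⊗ H} {d : H ⟶ H ⊗ H}
    (h : r ≫ r ▷ H ≫ (α_ _ _ _).hom = r ≫ D ◁ d) :
    dualLeftCoact r ≫ H ◁ dualLeftCoact r =
      dualLeftCoact (A := A) r ≫ d ▷ A ≫ (α_ _ _ _).hom := by
  have h1 := rightExtend_iterate (ε_ D A) (leftExtend_dualLeftCoact (A := A) r).symm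
  rw [rightExtend_comul _ h, leftExtend_evaluation, Equiv.eq_symm_apply,
    tensorRightHomEquiv_naturality] at h1
  have h2 : dualLeftCoact (A := A) r ≫ d ▷ A =
    dualLeftCoact r ≫ H ◁ dualLeftCoact r ≫ (α_ _ _ _).inv := h1
  rw [reassoc_of% h2]
  simp

end

section

variable {F : C ⥤ C} [F.OplaxMonoidal] [ExactPairing D A] {a : F.obj A ⟶ A} {b : F.obj D ⟶ D}
  {c : F.obj H ⟶ H}

/-- The adjoint coaction is a composite of linear morphisms. -/
theorem IsLinearPairing.dualRightCoact (hp : IsLinearPairing F b a) {l : A ⟶ H ⊗ A}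
    (hl : IsLinear a (tensorAct F c a) l) :
    IsLinear b (tensorAct F b c) (HopfMonad.dualRightCoact l : D ⟶ D ⊗ H) := by
  have h : IsLinear (tensorAct F a b) c (leftExtend l (ε_ D A)) :=
    (hl.whiskerRight b).comp <| (IsLinear.associator _ _ _).comp <|
      (hp.evaluation.whiskerLeft c).comp (IsLinear.rightUnitor c)
  exact (IsLinear.leftUnitor b).inv.comp <| (hp.coevaluation.whiskerRight b).comp <|
    (IsLinear.associator _ _ _).comp (h.whiskerLeft b)

theorem IsLinearPairing.dualLeftCoact (hp : IsLinearPairing F b a) {r : D ⟶ D ⊗ H}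
    (hr : IsLinear b (tensorAct F b c) r) :
    IsLinear a (tensorAct F c a) (HopfMonad.dualLeftCoact r : A ⟶ H ⊗ A) := by
  have h : IsLinear (tensorAct F a b) c (rightExtend r (ε_ D A)) :=
    (hr.whiskerLeft a).comp <| (IsLinear.associator _ _ _).inv.comp <|
      (hp.evaluation.whiskerRight c).comp (IsLinear.leftUnitor c)
  exact (IsLinear.rightUnitor a).inv.comp <| (hp.coevaluation.whiskerLeft a).comp <|
    (IsLinear.associator _ _ _).inv.comp (h.whiskerRight a)

end

end DualCoactions

section DualHopfModules

variable {C : Type u} [Category.{v} C] [MonoidalCategory C] [RigidCategory C] {T : Monad C}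
  [T.toFunctor.OplaxMonoidal] [IsBimonad T]

/-- The right dual of a left Hopf module is a right Hopf module. -/
def RightAntipode.dualHopfModule (s : RightAntipode T) (N : LeftHopfModule T) :
    RightHopfModule T where
  toAlgebra := s.dualAlgebra N.toAlgebra
  coact := dualRightCoact (D := (ᘁN.A : C)) N.coact
  coact_counit := dualRightCoact_counit (D := (ᘁN.A : C)) N.coact_counit
  coact_comul := dualRightCoact_comul (D := (ᘁN.A : C)) N.coact_comul
  act_coact := ((s.isLinearPairing N.toAlgebra).dualRightCoact N.isLinear_coact).symm

/-- The left dual of a right Hopf module is a left Hopf module. -/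
def LeftAntipode.dualHopfModule (s : LeftAntipode T) (N : RightHopfModule T) :
    LeftHopfModule T where
  toAlgebra := s.dualAlgebra N.toAlgebra
  coact := dualLeftCoact (A := N.Aᘁ) N.coact
  coact_counit := dualLeftCoact_counit (A := N.Aᘁ) N.coact_counit
  coact_comul := dualLeftCoact_comul (A := N.Aᘁ) N.coact_comul
  act_coact := ((s.isLinearPairing N.toAlgebra).dualLeftCoact N.isLinear_coact).symm

end DualHopfModules

/-! ### Integral forms -/

section AdjointCoactions

variable {C : Type u} [Category.{v} C] [MonoidalCategory C] {A B D H W : C}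

theorem leftExtend_whiskerLeft (l : A ⟶ H ⊗ A) (p : A ⊗ D ⟶ 𝟙_ C) (k : W ⟶ D) :
    leftExtend l (A ◁ k ≫ p) = A ◁ k ≫ leftExtend l p := by
  simp only [leftExtend]
  rw [whisker_exchange_assoc]
  simp

theorem rightExtend_whiskerRight (r : D ⟶ D ⊗ H) (p : A ⊗ D ⟶ 𝟙_ C) (h : W ⟶ A) :
    rightExtend r (h ▷ D ≫ p) = h ▷ D ≫ rightExtend r p := by
  simp only [rightExtend]
  rw [← whisker_exchange_assoc]
  simp

theorem leftExtend_whiskerRight {l : A ⟶ H ⊗ A} {l' : B ⟶ H ⊗ B} (p : A ⊗ D ⟶ 𝟙_ C) {h : B ⟶ A}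
    (w : h ≫ l = l' ≫ H ◁ h) : leftExtend l' (h ▷ D ≫ p) = h ▷ D ≫ leftExtend l p := by
  simp only [leftExtend]
  rw [← comp_whiskerRight_assoc, w]
  simp

theorem rightExtend_whiskerLeft {r : D ⟶ D ⊗ H} {r' : B ⟶ B ⊗ H} (p : A ⊗ D ⟶ 𝟙_ C) {k : B ⟶ D}
    (w : k ≫ r = r' ≫ k ▷ H) : rightExtend r' (A ◁ k ≫ p) = A ◁ k ≫ rightExtend r p := by
  simp only [rightExtend]
  rw [← whiskerLeft_comp_assoc, w]
  simp

/-- The extension along the trivial coaction given by `u` is composition with `u`. -/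
theorem leftExtend_trivial (u : 𝟙_ C ⟶ H) (p : A ⊗ D ⟶ 𝟙_ C) :
    leftExtend ((λ_ A).inv ≫ u ▷ A) p = p ≫ u := by
  calc _ = (λ_ A).inv ▷ D ≫ (α_ _ _ _).hom ≫ (u ▷ (A ⊗ D) ≫ H ◁ p) ≫ (ρ_ H).hom := by
        simp [leftExtend]
    _ = _ := by
        rw [← whisker_exchange]
        simp [← unitors_equal]

theorem rightExtend_trivial (u : 𝟙_ C ⟶ H) (p : A ⊗ D ⟶ 𝟙_ C) :
    rightExtend ((ρ_ D).inv ≫ D ◁ u) p = p ≫ u := by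
  calc _ = A ◁ (ρ_ D).inv ≫ (α_ _ _ _).inv ≫ ((A ⊗ D) ◁ u ≫ p ▷ H) ≫ (λ_ H).hom := by
        simp [rightExtend]
    _ = _ := by
        rw [whisker_exchange]
        simp [unitors_equal]

variable [ExactPairing D A]

theorem existsUnique_whiskerLeft_evaluation (a : A ⊗ W ⟶ 𝟙_ C) :
    ∃! k : W ⟶ D, A ◁ k ≫ ε_ D A = a := by
  have e (k : W ⟶ D) : (tensorLeftHomEquiv W D A (𝟙_ C)).symm (k ≫ (ρ_ D).inv) =
      A ◁ k ≫ ε_ D A := by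
    rw [tensorLeftHomEquiv_symm_naturality]
    simp [tensorLeftHomEquiv, unitors_equal]
  refine ⟨tensorLeftHomEquiv W D A (𝟙_ C) a ≫ (ρ_ D).hom, ?_, fun k hk => ?_⟩
  · dsimp only
    rw [← e]
    simp
  · rw [← hk, ← e]
    simp

theorem existsUnique_whiskerRight_evaluation (a : W ⊗ D ⟶ 𝟙_ C) :
    ∃! h : W ⟶ A, h ▷ D ≫ ε_ D A = a := by
  have e (h : W ⟶ A) : (tensorRightHomEquiv W D A (𝟙_ C)).symm (h ≫ (λ_ A).inv) =
      h ▷ D ≫ ε_ D A := by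
    rw [tensorRightHomEquiv_symm_naturality]
    simp [tensorRightHomEquiv, ← unitors_equal]
  refine ⟨tensorRightHomEquiv W D A (𝟙_ C) a ≫ (λ_ A).hom, ?_, fun h hh => ?_⟩
  · dsimp only
    rw [← e]
    simp
  · rw [← hh, ← e]
    simp

variable {l : A ⟶ H ⊗ A} {r : D ⟶ D ⊗ H}

/-- For adjoint coactions on the members of an exact pairing, coinvariant morphisms to one
member are the same as coinvariant forms on the other. -/
theorem comp_rightCoact_eq_iff (w : rightExtend r (ε_ D A) = leftExtend l (ε_ D A))
    (u : 𝟙_ C ⟶ H) (k : W ⟶ D) : k ≫ r = k ≫ (ρ_ D).inv ≫ D ◁ u ↔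
      leftExtend l (A ◁ k ≫ ε_ D A) = (A ◁ k ≫ ε_ D A) ≫ u := by
  rw [leftExtend_whiskerLeft, ← w, Category.assoc, ← rightExtend_trivial u (ε_ D A),
    rightExtend_evaluation, rightExtend_evaluation, ← tensorLeftHomEquiv_symm_naturality,
    ← tensorLeftHomEquiv_symm_naturality, EmbeddingLike.apply_eq_iff_eq]

theorem comp_leftCoact_eq_iff (w : rightExtend r (ε_ D A) = leftExtend l (ε_ D A))
    (u : 𝟙_ C ⟶ H) (h : W ⟶ A) : h ≫ l = h ≫ (λ_ A).inv ≫ u ▷ A ↔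
      rightExtend r (h ▷ D ≫ ε_ D A) = (h ▷ D ≫ ε_ D A) ≫ u := by
  rw [rightExtend_whiskerRight, w, Category.assoc, ← leftExtend_trivial u (ε_ D A),
    leftExtend_evaluation, leftExtend_evaluation, ← tensorRightHomEquiv_symm_naturality,
    ← tensorRightHomEquiv_symm_naturality, EmbeddingLike.apply_eq_iff_eq]

end AdjointCoactions

section Forms

variable {C : Type u} [Category.{v} C] [MonoidalCategory C] (T : Monad C)
  [T.toFunctor.OplaxMonoidal]

/-- A form on `T X ⊗ W` satisfying the left integral condition in its first argument. Such forms
correspond to morphisms from `T X` to the left dual of `W` satisfying the left integral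
condition. -/
def IsLeftForm {X W : C} (a : T.obj X ⊗ W ⟶ 𝟙_ C) : Prop :=
  leftExtend (freeLeftCoact T X) a = a ≫ T.η.app (𝟙_ C)

/-- A form on `W ⊗ T Z` satisfying the right integral condition in its second argument. Such forms
correspond to morphisms from `T Z` to the right dual of `W` satisfying the right integral
condition. -/
def IsRightForm {W Z : C} (a : W ⊗ T.obj Z ⟶ 𝟙_ C) : Prop :=
  rightExtend (freeRightCoact T Z) a = a ≫ T.η.app (𝟙_ C)

variable {T}

/-- The restriction to `T X ⊗ Z` of a form on `T X ⊗ T Z`. -/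
def leftRestrict {X Z : C} (ω : T.obj X ⊗ T.obj Z ⟶ 𝟙_ C) : T.obj X ⊗ Z ⟶ 𝟙_ C :=
  T.obj X ◁ T.η.app Z ≫ ω

/-- The restriction to `X ⊗ T Z` of a form on `T X ⊗ T Z`. -/
def rightRestrict {X Z : C} (ω : T.obj X ⊗ T.obj Z ⟶ 𝟙_ C) : X ⊗ T.obj Z ⟶ 𝟙_ C :=
  T.η.app X ▷ T.obj Z ≫ ω

/-- A linear form on `T X ⊗ T Z` whose restriction to `T X ⊗ Z` is universal among left integral
forms with first argument in `T X`, and whose restriction to `X ⊗ T Z` is universal among right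
integral forms with second argument in `T Z`. -/
structure IsUniversalPairing {X Z : C} (ω : T.obj X ⊗ T.obj Z ⟶ 𝟙_ C) : Prop where
  isLinear : IsLinear (tensorAct T.toFunctor (T.μ.app X) (T.μ.app Z)) (η T.toFunctor) ω
  isLeftForm : IsLeftForm T (leftRestrict ω)
  isRightForm : IsRightForm T (rightRestrict ω)
  existsUnique_left {W : C} (a : T.obj X ⊗ W ⟶ 𝟙_ C) : IsLeftForm T a →
    ∃! f : W ⟶ Z, T.obj X ◁ f ≫ leftRestrict ω = a
  existsUnique_right {W : C} (a : W ⊗ T.obj Z ⟶ 𝟙_ C) : IsRightForm T a →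
    ∃! f : W ⟶ X, f ▷ T.obj Z ≫ rightRestrict ω = a

/-- A perfect linear pairing of `T X` and `T Z` for which the coactions are adjoint is universal:
it identifies left integral forms on `T X ⊗ W` with coinvariant morphisms to `T Z`, and right
integral forms on `W ⊗ T Z` with coinvariant morphisms to `T X`. -/
theorem isUniversalPairing_evaluation {X Z : C} [ExactPairing (T.obj Z) (T.obj X)]
    (hX : IsEqualizer (freeLeftCoact T X) (leftTrivialCoaction T (T.obj X)) (T.η.app X))
    (hZ : IsEqualizer (freeRightCoact T Z) (rightTrivialCoaction T (T.obj Z)) (T.η.app Z))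
    (hlin : IsLinear (tensorAct T.toFunctor (T.μ.app X) (T.μ.app Z)) (η T.toFunctor)
      (ε_ (T.obj Z) (T.obj X)))
    (hadj : rightExtend (freeRightCoact T Z) (ε_ (T.obj Z) (T.obj X)) =
      leftExtend (freeLeftCoact T X) (ε_ (T.obj Z) (T.obj X))) :
    IsUniversalPairing (ε_ (T.obj Z) (T.obj X)) where
  isLinear := hlin
  isLeftForm := (comp_rightCoact_eq_iff hadj (T.η.app (𝟙_ C)) (T.η.app Z)).1 hZ.condition
  isRightForm := (comp_leftCoact_eq_iff hadj (T.η.app (𝟙_ C)) (T.η.app X)).1 hX.condition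
  existsUnique_left {W} a ha := by
    obtain ⟨k, rfl, hk⟩ := existsUnique_whiskerLeft_evaluation (D := T.obj Z) a
    obtain ⟨f, rfl, hf⟩ := hZ.existsUnique_lift k ((comp_rightCoact_eq_iff hadj _ k).2 ha)
    refine ⟨f, ?_, fun g hg => hf g (hk _ ?_)⟩
    · exact (whiskerLeft_comp_assoc _ _ _ _).symm
    · exact (whiskerLeft_comp_assoc _ _ _ _).trans hg
  existsUnique_right {W} a ha := by
    obtain ⟨k, rfl, hk⟩ := existsUnique_whiskerRight_evaluation (A := T.obj X) a
    obtain ⟨f, rfl, hf⟩ := hX.existsUnique_lift k ((comp_leftCoact_eq_iff hadj _ k).2 ha)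
    refine ⟨f, ?_, fun g hg => hf g (hk _ ?_)⟩
    · exact (comp_whiskerRight_assoc _ _ _ _).symm
    · exact (comp_whiskerRight_assoc _ _ _ _).trans hg

/-- An isomorphism of Hopf modules from `T Z` to a dual `D` of `T X` turns the evaluation of `D`
into a universal pairing. -/
theorem isUniversalPairing_of_iso_left {X Z D : C} [ExactPairing D (T.obj X)]
    {d : T.obj D ⟶ D} {r : D ⟶ D ⊗ T.obj (𝟙_ C)}
    (hX : IsEqualizer (freeLeftCoact T X) (leftTrivialCoaction T (T.obj X)) (T.η.app X))
    (hZ : IsEqualizer (freeRightCoact T Z) (rightTrivialCoaction T (T.obj Z)) (T.η.app Z))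
    (hp : IsLinearPairing T.toFunctor d (T.μ.app X))
    (hadj : rightExtend r (ε_ D (T.obj X)) = leftExtend (freeLeftCoact T X) (ε_ D (T.obj X)))
    (θ : T.obj Z ≅ D) (hlin : IsLinear (F := T.toFunctor) (T.μ.app Z) d θ.hom)
    (hco : θ.hom ≫ r = freeRightCoact T Z ≫ θ.hom ▷ T.obj (𝟙_ C)) :
    IsUniversalPairing (T.obj X ◁ θ.hom ≫ ε_ D (T.obj X)) := by
  let := exactPairingCongrLeft (Y := T.obj X) θ
  refine isUniversalPairing_evaluation hX hZ ((hlin.whiskerLeft _).comp hp.evaluation) ?_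
  change rightExtend _ (T.obj X ◁ θ.hom ≫ ε_ D (T.obj X)) =
    leftExtend _ (T.obj X ◁ θ.hom ≫ ε_ D (T.obj X))
  rw [rightExtend_whiskerLeft _ hco, leftExtend_whiskerLeft, hadj]

/-- An isomorphism of Hopf modules from `T X` to a dual `A` of `T Z` turns the evaluation of `A`
into a universal pairing. -/
theorem isUniversalPairing_of_iso_right {X Z A : C} [ExactPairing (T.obj Z) A]
    {a : T.obj A ⟶ A} {l : A ⟶ T.obj (𝟙_ C) ⊗ A}
    (hX : IsEqualizer (freeLeftCoact T X) (leftTrivialCoaction T (T.obj X)) (T.η.app X))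
    (hZ : IsEqualizer (freeRightCoact T Z) (rightTrivialCoaction T (T.obj Z)) (T.η.app Z))
    (hp : IsLinearPairing T.toFunctor (T.μ.app Z) a)
    (hadj : rightExtend (freeRightCoact T Z) (ε_ (T.obj Z) A) = leftExtend l (ε_ (T.obj Z) A))
    (θ : T.obj X ≅ A) (hlin : IsLinear (F := T.toFunctor) (T.μ.app X) a θ.hom)
    (hco : θ.hom ≫ l = freeLeftCoact T X ≫ T.obj (𝟙_ C) ◁ θ.hom) :
    IsUniversalPairing (θ.hom ▷ T.obj Z ≫ ε_ (T.obj Z) A) := by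
  let := exactPairingCongrRight (X := T.obj Z) θ
  refine isUniversalPairing_evaluation hX hZ ((hlin.whiskerRight _).comp hp.evaluation) ?_
  change rightExtend _ (θ.hom ▷ T.obj Z ≫ ε_ (T.obj Z) A) =
    leftExtend _ (θ.hom ▷ T.obj Z ≫ ε_ (T.obj Z) A)
  rw [rightExtend_whiskerRight, leftExtend_whiskerRight _ hco, hadj]

theorem RightHopfModule.exists_coinvariants (h : HopfModulesAdmitPreservedCoinvariants T)
    (M : RightHopfModule T) : ∃ (E : C) (i : E ⟶ M.A),
      IsPreservedEqualizer T.toFunctor M.coact (rightTrivialCoaction T M.A) i :=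
  exists_isPreservedEqualizer _ _ _ (h.2 M).1 (h.2 M).2

theorem LeftHopfModule.exists_coinvariants (h : HopfModulesAdmitPreservedCoinvariants T)
    (M : LeftHopfModule T) : ∃ (E : C) (i : E ⟶ M.A),
      IsPreservedEqualizer T.toFunctor M.coact (leftTrivialCoaction T M.A) i :=
  exists_isPreservedEqualizer _ _ _ (h.1 M).1 (h.1 M).2

variable [RigidCategory C] [IsHopfMonad T] [T.toFunctor.ReflectsIsomorphisms]

theorem isEqualizer_freeRightCoact (h : HopfModulesAdmitPreservedCoinvariants T) (X : C) :
    IsEqualizer (freeRightCoact T X) (rightTrivialCoaction T (T.obj X)) (T.η.app X) := by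
  obtain ⟨s⟩ := IsHopfMonad.exists_rightAntipode (T := T)
  obtain ⟨E, i, hi⟩ := (freeRightHopfModule T X).exists_coinvariants h
  exact s.isEqualizer_unit hi

theorem isEqualizer_freeLeftCoact (h : HopfModulesAdmitPreservedCoinvariants T) (X : C) :
    IsEqualizer (freeLeftCoact T X) (leftTrivialCoaction T (T.obj X)) (T.η.app X) := by
  obtain ⟨s⟩ := IsHopfMonad.exists_leftAntipode (T := T)
  obtain ⟨E, i, hi⟩ := (freeLeftHopfModule T X).exists_coinvariants h
  exact s.isEqualizer_unit hi

/-- The second member is the object of coinvariants of the right dual of `T X`, of which this dual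
is the free module by the fundamental theorem. -/
theorem exists_isUniversalPairing_left (h : HopfModulesAdmitPreservedCoinvariants T) (X : C) :
    ∃ (Z : C) (ω : T.obj X ⊗ T.obj Z ⟶ 𝟙_ C), IsUniversalPairing ω := by
  obtain ⟨s⟩ := IsHopfMonad.exists_rightAntipode (T := T)
  let M := s.dualHopfModule (freeLeftHopfModule T X)
  obtain ⟨E, i, hi⟩ := M.exists_coinvariants h
  have hiso := M.isIso_map_act s hi
  have hco := M.map_act_coact hi.isEqualizer.condition
  rw [rightFusion, reassoc_of% @freeRightCoact_naturality, ← comp_whiskerRight] at hco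
  exact ⟨E, _, isUniversalPairing_of_iso_left (D := (ᘁ(T.obj X) : C))
    (isEqualizer_freeLeftCoact h X) (isEqualizer_freeRightCoact h E)
    (s.isLinearPairing (T.free.obj X)) (rightExtend_dualRightCoact (freeLeftCoact T X))
    (@asIso _ _ _ _ _ hiso) (isLinear_map_act M.toAlgebra i) hco⟩

/-- The first member is the object of coinvariants of the left dual of `T Z`, of which this dual
is the free module by the fundamental theorem. -/
theorem exists_isUniversalPairing_right (h : HopfModulesAdmitPreservedCoinvariants T) (Z : C) :
    ∃ (X : C) (ω : T.obj X ⊗ T.obj Z ⟶ 𝟙_ C), IsUniversalPairing ω := by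
  obtain ⟨s⟩ := IsHopfMonad.exists_leftAntipode (T := T)
  let M := s.dualHopfModule (freeRightHopfModule T Z)
  obtain ⟨E, i, hi⟩ := M.exists_coinvariants h
  have hiso := M.isIso_map_act s hi
  have hco := M.map_act_coact hi.isEqualizer.condition
  rw [leftFusion, reassoc_of% @freeLeftCoact_naturality, ← whiskerLeft_comp] at hco
  exact ⟨E, _, isUniversalPairing_of_iso_right (A := (T.obj Z)ᘁ)
    (isEqualizer_freeLeftCoact h E) (isEqualizer_freeRightCoact h Z)
    (s.isLinearPairing (T.free.obj Z)) (leftExtend_dualLeftCoact (freeRightCoact T Z)).symm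
    (@asIso _ _ _ _ _ hiso) (isLinear_map_act M.toAlgebra i) hco⟩

end Forms

/-! ### Universal integrals from universal forms -/

section UniversalIntegrals

variable {C : Type u} [Category.{v} C]

/-- Factorizations through a componentwise epimorphic transformation are natural. -/
theorem existsUnique_natTrans_fac {F I K : C ⥤ C} (l : F ⟶ I) (c : F ⟶ K)
    [∀ X, Epi (l.app X)] (h : ∀ X, ∃ f : I.obj X ⟶ K.obj X, l.app X ≫ f = c.app X) :
    ∃! f : I ⟶ K, c = l ≫ f := by
  choose f hf using h
  refine ⟨⟨f, fun X Y g => ?_⟩, ?_, fun g hg => ?_⟩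
  · rw [← cancel_epi (l.app X), ← l.naturality_assoc, hf, reassoc_of% hf, c.naturality]
  · ext X
    exact (hf X).symm
  · ext X
    rw [← cancel_epi (l.app X), hf, hg]
    rfl

variable [MonoidalCategory C]

/-- For the pairing induced by `c : A ⟶ B`, the extension along `l` is the transpose of
`l ≫ H ◁ c`. -/
theorem leftExtend_whiskerRight_evaluation {A B D H : C} [ExactPairing D B] (l : A ⟶ H ⊗ A)
    (c : A ⟶ B) : leftExtend l (c ▷ D ≫ ε_ D B) =
      (tensorRightHomEquiv A D B H).symm (l ≫ H ◁ c) := by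
  simp [leftExtend, tensorRightHomEquiv]

theorem rightExtend_whiskerLeft_evaluation {A B D H : C} [ExactPairing B A] (r : D ⟶ D ⊗ H)
    (c : D ⟶ B) : rightExtend r (A ◁ c ≫ ε_ B A) =
      (tensorLeftHomEquiv D B A H).symm (r ≫ c ▷ H) := by
  simp [rightExtend, tensorLeftHomEquiv]

variable (T : Monad C) [T.toFunctor.OplaxMonoidal]

/-- The left integral condition for a single morphism `T X ⟶ K`. -/
def IsLeftIntegralAt {X K : C} (c : T.obj X ⟶ K) : Prop :=
  freeLeftCoact T X ≫ T.obj (𝟙_ C) ◁ c = leftTrivialCoaction T (T.obj X) ≫ T.obj (𝟙_ C) ◁ c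

/-- The right integral condition for a single morphism `T X ⟶ K`. -/
def IsRightIntegralAt {X K : C} (c : T.obj X ⟶ K) : Prop :=
  freeRightCoact T X ≫ c ▷ T.obj (𝟙_ C) = rightTrivialCoaction T (T.obj X) ≫ c ▷ T.obj (𝟙_ C)

variable {T}

theorem isLeftIntegral_iff {K : C ⥤ C} (c : T.toFunctor ⟶ K) :
    IsLeftIntegral T c ↔ ∀ X, IsLeftIntegralAt T (c.app X) := by
  refine forall_congr' fun X => ?_
  rw [IsLeftIntegralAt, freeLeftCoact, leftTrivialCoaction, MonoidalCategory.tensorHom_def,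
    Category.assoc, Category.assoc]

theorem isRightIntegral_iff {K : C ⥤ C} (c : T.toFunctor ⟶ K) :
    IsRightIntegral T c ↔ ∀ X, IsRightIntegralAt T (c.app X) := by
  refine forall_congr' fun X => ?_
  rw [IsRightIntegralAt, freeRightCoact, rightTrivialCoaction, MonoidalCategory.tensorHom_def',
    Category.assoc, Category.assoc]

theorem IsLeftIntegralAt.comp {X K K' : C} {c : T.obj X ⟶ K} (h : IsLeftIntegralAt T c)
    (f : K ⟶ K') : IsLeftIntegralAt T (c ≫ f) := by
  unfold IsLeftIntegralAt at *
  rw [whiskerLeft_comp, reassoc_of% h]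

theorem IsRightIntegralAt.comp {X K K' : C} {c : T.obj X ⟶ K} (h : IsRightIntegralAt T c)
    (f : K ⟶ K') : IsRightIntegralAt T (c ≫ f) := by
  unfold IsRightIntegralAt at *
  rw [comp_whiskerRight, reassoc_of% h]

/-- Duality between morphisms and forms with the left integral property. -/
theorem isLeftForm_iff {X K D : C} [ExactPairing D K] (c : T.obj X ⟶ K) :
    IsLeftForm T (c ▷ D ≫ ε_ D K) ↔ IsLeftIntegralAt T c := by
  rw [IsLeftForm, ← leftExtend_trivial, leftExtend_whiskerRight_evaluation,
    leftExtend_whiskerRight_evaluation, EmbeddingLike.apply_eq_iff_eq]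
  rfl

/-- Duality between morphisms and forms with the right integral property. -/
theorem isRightForm_iff {X K D : C} [ExactPairing K D] (c : T.obj X ⟶ K) :
    IsRightForm T (D ◁ c ≫ ε_ K D) ↔ IsRightIntegralAt T c := by
  rw [IsRightForm, ← rightExtend_trivial, rightExtend_whiskerLeft_evaluation,
    rightExtend_whiskerLeft_evaluation, EmbeddingLike.apply_eq_iff_eq]
  rfl

variable [RigidCategory C]

/-- The dual of a universal left integral form is a universal left integral morphism:
factorizations `Y ⟶ K` are the transposes of the morphisms from the right dual of `K` to `Z`. -/
theorem existsUnique_fac_of_leftForm {X Z Y : C} [ExactPairing Z Y] {l : T.obj X ⟶ Y}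
    (h : ∀ {W : C} (a : T.obj X ⊗ W ⟶ 𝟙_ C), IsLeftForm T a →
      ∃! f : W ⟶ Z, T.obj X ◁ f ≫ l ▷ Z ≫ ε_ Z Y = a)
    {K : C} {c : T.obj X ⟶ K} (hc : IsLeftIntegralAt T c) : ∃! f : Y ⟶ K, l ≫ f = c := by
  have key {f : Y ⟶ K} {g : (ᘁK : C) ⟶ Z} (e : Y ◁ g ≫ ε_ Z Y = f ▷ (ᘁK : C) ≫ ε_ (ᘁK : C) K) :
      T.obj X ◁ g ≫ l ▷ Z ≫ ε_ Z Y = (l ≫ f) ▷ (ᘁK : C) ≫ ε_ (ᘁK : C) K := by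
    rw [whisker_exchange_assoc, e, comp_whiskerRight_assoc]
  obtain ⟨g, hg, hg'⟩ := h _ ((isLeftForm_iff (D := (ᘁK : C)) c).2 hc)
  obtain ⟨f, hf, hf'⟩ := existsUnique_whiskerRight_evaluation (D := (ᘁK : C)) (A := K)
    (Y ◁ g ≫ ε_ Z Y)
  refine ⟨f, ?_, fun k hk => hf' k ?_⟩
  · exact (existsUnique_whiskerRight_evaluation (D := (ᘁK : C)) (A := K) _).unique
      ((key hf.symm).symm.trans hg) rfl
  · obtain ⟨g', e, -⟩ := existsUnique_whiskerLeft_evaluation (D := Z) (A := Y)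
      (k ▷ (ᘁK : C) ≫ ε_ (ᘁK : C) K)
    have := key e
    rw [hk] at this
    rw [← hg' g' this]
    exact e.symm

/-- The dual of a universal right integral form is a universal right integral morphism:
factorizations `Y ⟶ K` are the transposes of the morphisms from the left dual of `K` to `Z`. -/
theorem existsUnique_fac_of_rightForm {X Z Y : C} [ExactPairing Y Z] {l : T.obj X ⟶ Y}
    (h : ∀ {W : C} (a : W ⊗ T.obj X ⟶ 𝟙_ C), IsRightForm T a →
      ∃! f : W ⟶ Z, f ▷ T.obj X ≫ Z ◁ l ≫ ε_ Y Z = a)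
    {K : C} {c : T.obj X ⟶ K} (hc : IsRightIntegralAt T c) : ∃! f : Y ⟶ K, l ≫ f = c := by
  have key {f : Y ⟶ K} {g : Kᘁ ⟶ Z} (e : g ▷ Y ≫ ε_ Y Z = Kᘁ ◁ f ≫ ε_ K Kᘁ) :
      g ▷ T.obj X ≫ Z ◁ l ≫ ε_ Y Z = Kᘁ ◁ (l ≫ f) ≫ ε_ K Kᘁ := by
    rw [← whisker_exchange_assoc, e, whiskerLeft_comp_assoc]
  obtain ⟨g, hg, hg'⟩ := h _ ((isRightForm_iff (D := Kᘁ) c).2 hc)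
  obtain ⟨f, hf, hf'⟩ := existsUnique_whiskerLeft_evaluation (D := K) (A := Kᘁ)
    (g ▷ Y ≫ ε_ Y Z)
  refine ⟨f, ?_, fun k hk => hf' k ?_⟩
  · exact (existsUnique_whiskerLeft_evaluation (D := K) (A := Kᘁ) _).unique
      ((key hf.symm).symm.trans hg) rfl
  · obtain ⟨g', e, -⟩ := existsUnique_whiskerRight_evaluation (D := Y) (A := Z)
      (Kᘁ ◁ k ≫ ε_ K Kᘁ)
    have := key e
    rw [hk] at this
    rw [← hg' g' this]
    exact e.symm

variable (C) in
/-- The contravariant functor sending an object to its left dual. -/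
def leftDual : Cᵒᵖ ⥤ C where
  obj X := X.unopᘁ
  map f := f.unopᘁ
  map_id X := by simp
  map_comp f g := by rw [unop_comp, comp_rightAdjointMate]

variable (C) in
/-- The contravariant functor sending an object to its right dual. -/
def rightDual : Cᵒᵖ ⥤ C where
  obj X := (ᘁX.unop : C)
  map f := (ᘁf.unop)
  map_id X := by simp
  map_comp f g := by rw [unop_comp, comp_leftAdjointMate]

/-- A natural family of universal left integral forms on `T X ⊗ L X`, with `L` contravariant,
gives a universal left integral with values in the left dual of `L`. -/
theorem exists_isUniversalLeftIntegral (L : C ⥤ Cᵒᵖ)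
    (b : ∀ X, T.obj X ⊗ (L.obj X).unop ⟶ 𝟙_ C)
    (hn : ∀ {X Y : C} (f : X ⟶ Y),
      T.obj X ◁ (L.map f).unop ≫ b X = T.map f ▷ (L.obj Y).unop ≫ b Y)
    (hb : ∀ X, IsLeftForm T (b X))
    (hu : ∀ {X W : C} (a : T.obj X ⊗ W ⟶ 𝟙_ C), IsLeftForm T a →
      ∃! f : W ⟶ (L.obj X).unop, T.obj X ◁ f ≫ b X = a) :
    ∃ l : T.toFunctor ⟶ L ⋙ leftDual C, IsUniversalLeftIntegral T l := by
  choose l hl using fun X => (existsUnique_whiskerRight_evaluation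
    (D := (L.obj X).unop) (A := (L.obj X).unopᘁ) (b X)).exists
  have hint (X : C) : IsLeftIntegralAt T (l X) := by
    rw [← isLeftForm_iff (D := (L.obj X).unop), hl]
    exact hb X
  have hfac {X K : C} {c : T.obj X ⟶ K} (hc : IsLeftIntegralAt T c) :
      ∃! f : (L.obj X).unopᘁ ⟶ K, l X ≫ f = c :=
    existsUnique_fac_of_leftForm (fun a ha => by rw [hl]; exact hu a ha) hc
  have hepi (X : C) : Epi (l X) :=
    ⟨fun g h e => (hfac ((hint X).comp h)).unique e rfl⟩
  have hnat {X Y : C} (f : X ⟶ Y) : T.map f ≫ l Y = l X ≫ ((L.map f).unop)ᘁ := by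
    refine (existsUnique_whiskerRight_evaluation (D := (L.obj Y).unop)
      (A := (L.obj Y).unopᘁ) _).unique rfl ?_
    rw [comp_whiskerRight_assoc, comp_whiskerRight_assoc, hl, ← hn,
      rightAdjointMate_comp_evaluation, ← whisker_exchange_assoc, hl]
  exact ⟨⟨l, fun _ _ f => hnat f⟩, (isLeftIntegral_iff _).2 hint, fun K c hc =>
    @existsUnique_natTrans_fac _ _ _ _ _ _ c hepi fun X =>
      (hfac ((isLeftIntegral_iff c).1 hc X)).exists⟩

/-- A natural family of universal right integral forms on `R X ⊗ T X`, with `R` contravariant,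
gives a universal right integral with values in the right dual of `R`. -/
theorem exists_isUniversalRightIntegral (R : C ⥤ Cᵒᵖ)
    (b : ∀ X, (R.obj X).unop ⊗ T.obj X ⟶ 𝟙_ C)
    (hn : ∀ {X Y : C} (f : X ⟶ Y),
      (R.map f).unop ▷ T.obj X ≫ b X = (R.obj Y).unop ◁ T.map f ≫ b Y)
    (hb : ∀ X, IsRightForm T (b X))
    (hu : ∀ {X W : C} (a : W ⊗ T.obj X ⟶ 𝟙_ C), IsRightForm T a →
      ∃! f : W ⟶ (R.obj X).unop, f ▷ T.obj X ≫ b X = a) :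
    ∃ r : T.toFunctor ⟶ R ⋙ rightDual C, IsUniversalRightIntegral T r := by
  choose l hl using fun X => (existsUnique_whiskerLeft_evaluation
    (D := (ᘁ(R.obj X).unop : C)) (A := (R.obj X).unop) (b X)).exists
  have hint (X : C) : IsRightIntegralAt T (l X) := by
    rw [← isRightForm_iff (D := (R.obj X).unop), hl]
    exact hb X
  have hfac {X K : C} {c : T.obj X ⟶ K} (hc : IsRightIntegralAt T c) :
      ∃! f : (ᘁ(R.obj X).unop : C) ⟶ K, l X ≫ f = c :=
    existsUnique_fac_of_rightForm (fun a ha => by rw [hl]; exact hu a ha) hc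
  have hepi (X : C) : Epi (l X) :=
    ⟨fun g h e => (hfac ((hint X).comp h)).unique e rfl⟩
  have hnat {X Y : C} (f : X ⟶ Y) : T.map f ≫ l Y = l X ≫ (ᘁ(R.map f).unop) := by
    refine (existsUnique_whiskerLeft_evaluation (D := (ᘁ(R.obj Y).unop : C))
      (A := (R.obj Y).unop) _).unique rfl ?_
    rw [whiskerLeft_comp_assoc, whiskerLeft_comp_assoc, hl, ← hn,
      leftAdjointMate_comp_evaluation, whisker_exchange_assoc, hl]
  exact ⟨⟨l, fun _ _ f => hnat f⟩, (isRightIntegral_iff _).2 hint, fun K c hc =>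
    @existsUnique_natTrans_fac _ _ _ _ _ _ c hepi fun X =>
      (hfac ((isRightIntegral_iff c).1 hc X)).exists⟩

end UniversalIntegrals

/-! ### The anti-equivalence defined by universal pairings -/

section PairingFunctor

variable {C : Type u} [Category.{v} C] [MonoidalCategory C] {T : Monad C}

theorem leftRestrict_comm {X X' Z Z' : C} {ω : T.obj X ⊗ T.obj Z ⟶ 𝟙_ C}
    {ω' : T.obj X' ⊗ T.obj Z' ⟶ 𝟙_ C} {f : X ⟶ X'} {g : Z' ⟶ Z}
    (e : T.obj X ◁ T.map g ≫ ω = T.map f ▷ T.obj Z' ≫ ω') :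
    T.obj X ◁ g ≫ leftRestrict ω = T.map f ▷ Z' ≫ leftRestrict ω' := by
  have h : g ≫ T.η.app Z = T.η.app Z' ≫ T.map g := T.η.naturality g
  rw [leftRestrict, leftRestrict, ← whisker_exchange_assoc]
  rw [← e, ← whiskerLeft_comp_assoc, ← whiskerLeft_comp_assoc, ← h]

theorem rightRestrict_comm {X X' Z Z' : C} {ω : T.obj X ⊗ T.obj Z ⟶ 𝟙_ C}
    {ω' : T.obj X' ⊗ T.obj Z' ⟶ 𝟙_ C} {f : X ⟶ X'} {g : Z' ⟶ Z}
    (e : T.obj X ◁ T.map g ≫ ω = T.map f ▷ T.obj Z' ≫ ω') :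
    X ◁ T.map g ≫ rightRestrict ω = f ▷ T.obj Z' ≫ rightRestrict ω' := by
  have h : f ≫ T.η.app X' = T.η.app X ≫ T.map f := T.η.naturality f
  rw [rightRestrict, rightRestrict, whisker_exchange_assoc]
  rw [e, ← comp_whiskerRight_assoc, ← comp_whiskerRight_assoc, ← h]

variable [T.toFunctor.OplaxMonoidal]

/-- A linear pairing of free modules is determined by its restriction to `T X ⊗ Z`, through the left
fusion operator. -/
theorem fusionLeft_comp_of_isLinear {X Z : C} {ω : T.obj X ⊗ T.obj Z ⟶ 𝟙_ C}
    (h : IsLinear (tensorAct T.toFunctor (T.μ.app X) (T.μ.app Z)) (η T.toFunctor) ω) :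
    fusionLeft T.toFunctor (T.μ.app X) Z ≫ ω = T.map (leftRestrict ω) ≫ η T.toFunctor := by
  have hu : T.map (T.η.app Z) ≫ T.μ.app Z = 𝟙 (T.obj Z) := T.right_unit _
  unfold IsLinear at h
  rw [leftRestrict, T.map_comp, Category.assoc, h, tensorAct, Category.assoc,
    ← δ_natural_right_assoc, MonoidalCategory.tensorHom_def', Category.assoc,
    ← whiskerLeft_comp_assoc, hu]
  erw [whiskerLeft_id_assoc]
  rw [fusionLeft, Category.assoc]

/-- A linear pairing of free modules is determined by its restriction to `X ⊗ T Z`, through the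
right fusion operator. -/
theorem fusionRight_comp_of_isLinear {X Z : C} {ω : T.obj X ⊗ T.obj Z ⟶ 𝟙_ C}
    (h : IsLinear (tensorAct T.toFunctor (T.μ.app X) (T.μ.app Z)) (η T.toFunctor) ω) :
    fusionRight T.toFunctor (T.μ.app Z) X ≫ ω = T.map (rightRestrict ω) ≫ η T.toFunctor := by
  have hu : T.map (T.η.app X) ≫ T.μ.app X = 𝟙 (T.obj X) := T.right_unit _
  unfold IsLinear at h
  rw [rightRestrict, T.map_comp, Category.assoc, h, tensorAct, Category.assoc,
    ← δ_natural_left_assoc, MonoidalCategory.tensorHom_def, Category.assoc,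
    ← comp_whiskerRight_assoc, hu]
  erw [id_whiskerRight_assoc]
  rw [fusionRight, Category.assoc]
  rfl

variable [RigidCategory C] [IsHopfMonad T]

/-- Two linear pairings are compatible with `f` and `g` if their left restrictions are, since the
fusion operators are invertible. -/
theorem map_comm_of_leftRestrict {X X' Z Z' : C} {ω : T.obj X ⊗ T.obj Z ⟶ 𝟙_ C}
    {ω' : T.obj X' ⊗ T.obj Z' ⟶ 𝟙_ C}
    (h : IsLinear (tensorAct T.toFunctor (T.μ.app X) (T.μ.app Z)) (η T.toFunctor) ω)
    (h' : IsLinear (tensorAct T.toFunctor (T.μ.app X') (T.μ.app Z')) (η T.toFunctor) ω')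
    {f : X ⟶ X'} {g : Z' ⟶ Z} (e : T.obj X ◁ g ≫ leftRestrict ω = T.map f ▷ Z' ≫ leftRestrict ω') :
    T.obj X ◁ T.map g ≫ ω = T.map f ▷ T.obj Z' ≫ ω' := by
  obtain ⟨s⟩ := IsHopfMonad.exists_rightAntipode (T := T)
  have : IsIso (fusionLeft T.toFunctor (T.μ.app X) Z') :=
    (s.isLinearPairing (T.free.obj X)).isIso_fusionLeft Z'
  have hf : IsLinear (F := T.toFunctor) (T.μ.app X) (T.μ.app X') (T.map f) := T.μ.naturality f
  rw [← cancel_epi (fusionLeft T.toFunctor (T.μ.app X) Z'), ← reassoc_of% @fusionLeft_naturality,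
    fusionLeft_comp_of_isLinear h, ← T.map_comp_assoc, e, T.map_comp_assoc,
    ← fusionLeft_comp_of_isLinear h', reassoc_of% hf.fusionLeft_comm]

theorem map_comm_of_rightRestrict {X X' Z Z' : C} {ω : T.obj X ⊗ T.obj Z ⟶ 𝟙_ C}
    {ω' : T.obj X' ⊗ T.obj Z' ⟶ 𝟙_ C}
    (h : IsLinear (tensorAct T.toFunctor (T.μ.app X) (T.μ.app Z)) (η T.toFunctor) ω)
    (h' : IsLinear (tensorAct T.toFunctor (T.μ.app X') (T.μ.app Z')) (η T.toFunctor) ω')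
    {f : X ⟶ X'} {g : Z' ⟶ Z}
    (e : X ◁ T.map g ≫ rightRestrict ω = f ▷ T.obj Z' ≫ rightRestrict ω') :
    T.obj X ◁ T.map g ≫ ω = T.map f ▷ T.obj Z' ≫ ω' := by
  obtain ⟨s⟩ := IsHopfMonad.exists_leftAntipode (T := T)
  have : IsIso (fusionRight T.toFunctor (T.μ.app Z') X) :=
    (s.isLinearPairing (T.free.obj Z')).isIso_fusionRight X
  have hg : IsLinear (F := T.toFunctor) (T.μ.app Z') (T.μ.app Z) (T.map g) := T.μ.naturality g
  rw [← cancel_epi (fusionRight T.toFunctor (T.μ.app Z') X), ← reassoc_of% @fusionRight_naturality,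
    fusionRight_comp_of_isLinear h', ← T.map_comp_assoc, ← e, T.map_comp_assoc,
    ← fusionRight_comp_of_isLinear h, reassoc_of% hg.fusionRight_comm]

variable [T.toFunctor.ReflectsIsomorphisms]

/-- Assigning to `X` the second member of a universal pairing with first member `X` is an
anti-equivalence. It is fully faithful because a universal pairing is universal on both sides, and
essentially surjective because every object is the second member of a universal pairing. -/
theorem exists_pairingFunctor (hT : HopfModulesAdmitPreservedCoinvariants T) :
    ∃ (E : Cᵒᵖ ⥤ C) (ω : ∀ X : C, T.obj X ⊗ T.obj (E.obj (.op X)) ⟶ 𝟙_ C),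
      (∀ X, IsUniversalPairing (ω X)) ∧
      (∀ {X Y : C} (f : X ⟶ Y), T.obj X ◁ T.map (E.map f.op) ≫ ω X =
        T.map f ▷ T.obj (E.obj (.op Y)) ≫ ω Y) ∧ E.IsEquivalence := by
  choose Z ω h using exists_isUniversalPairing_left hT
  have hf {X Y : C} (f : X ⟶ Y) : IsLeftForm T (T.map f ▷ Z Y ≫ leftRestrict (ω Y)) := by
    have := (h Y).isLeftForm
    unfold IsLeftForm at *
    rw [leftExtend_whiskerRight _ (freeLeftCoact_naturality f), this, Category.assoc]
  have hg {X Y : C} (g : Z Y ⟶ Z X) : IsRightForm T (X ◁ T.map g ≫ rightRestrict (ω X)) := by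
    have := (h X).isRightForm
    unfold IsRightForm at *
    rw [rightExtend_whiskerLeft _ (freeRightCoact_naturality g), this, Category.assoc]
  choose m hm hm' using fun (X Y : C) (f : X ⟶ Y) => (h X).existsUnique_left _ (hf f)
  dsimp only at hm
  have hom_ext {X W : C} {k l : W ⟶ Z X}
      (e : T.obj X ◁ k ≫ leftRestrict (ω X) = T.obj X ◁ l ≫ leftRestrict (ω X)) : k = l := by
    refine ((h X).existsUnique_left (T.obj X ◁ l ≫ leftRestrict (ω X)) ?_).unique e rfl
    have := (h X).isLeftForm
    unfold IsLeftForm at *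
    rw [leftExtend_whiskerLeft, this, Category.assoc]
  let E : Cᵒᵖ ⥤ C :=
    { obj := fun X => Z X.unop
      map := fun f => m _ _ f.unop
      map_id := fun X => hom_ext (by
        rw [hm, unop_id, T.map_id]
        simp)
      map_comp := fun {X Y W} f g => hom_ext (by
        rw [hm, whiskerLeft_comp_assoc, hm, unop_comp, T.map_comp, comp_whiskerRight_assoc,
          whisker_exchange_assoc, hm]) }
  have hE {X Y : C} (f : X ⟶ Y) : T.obj X ◁ T.map (m X Y f) ≫ ω X =
      T.map f ▷ T.obj (Z Y) ≫ ω Y :=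
    map_comm_of_leftRestrict (h X).isLinear (h Y).isLinear (hm X Y f)
  refine ⟨E, ω, h, fun f => hE f, ⟨⟨fun {X Y} f g e => ?_⟩, ⟨fun {X Y} g => ?_⟩, ⟨fun W => ?_⟩⟩⟩
  -- Faithful: by right universality `f` is recovered from the morphism `E f`.
  · apply Quiver.Hom.unop_inj
    have hfr := rightRestrict_comm (hE f.unop)
    have hgr := rightRestrict_comm (hE g.unop)
    rw [show m _ _ f.unop = m _ _ g.unop from e] at hfr
    exact ((h X.unop).existsUnique_right _ (hg _)).unique hfr.symm hgr.symm
  -- Full: right universality produces `f` from `g`, and compatibility of the restrictions to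
  -- `X ⊗ T Z` passes through the pairing to the restrictions to `T X ⊗ Z`.
  · obtain ⟨f, hf', -⟩ := (h X.unop).existsUnique_right _ (hg g)
    refine ⟨f.op, (hm' _ _ f g ?_).symm⟩
    exact leftRestrict_comm (map_comm_of_rightRestrict (h Y.unop).isLinear (h X.unop).isLinear
      hf'.symm)
  -- `W` and `E X` both represent left integral forms with first argument in `T X`.
  · obtain ⟨X, ω', h'⟩ := exists_isUniversalPairing_right hT W
    obtain ⟨k, hk, -⟩ := (h X).existsUnique_left _ h'.isLeftForm
    obtain ⟨l, hl, -⟩ := h'.existsUnique_left _ (h X).isLeftForm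
    refine ⟨.op X, ⟨⟨l, k, ?_, ?_⟩⟩⟩
    · exact hom_ext (by rw [whiskerLeft_comp_assoc, hk, hl]; simp)
    · exact (h'.existsUnique_left _ h'.isLeftForm).unique
        (by rw [whiskerLeft_comp_assoc, hl, hk]) (by simp)

end PairingFunctor

/-! ### Double duals and quasi-inverses -/

section QuasiInverse

variable {C : Type u} [Category.{v} C]

theorem AreQuasiInverse.isEquivalence {F G : C ⥤ C} (h : AreQuasiInverse F G) :
    G.IsEquivalence := by
  obtain ⟨⟨e⟩, ⟨e'⟩⟩ := h
  exact (CategoryTheory.Equivalence.mk G F e'.symm e).isEquivalence_functor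

theorem AreQuasiInverse.of_iso {F F' G : C ⥤ C} (h : AreQuasiInverse F' G) (i : F ≅ F') :
    AreQuasiInverse F G := by
  obtain ⟨⟨e⟩, ⟨e'⟩⟩ := h
  exact ⟨⟨Functor.isoWhiskerRight i G ≪≫ e⟩, ⟨Functor.isoWhiskerLeft G i ≪≫ e'⟩⟩

/-- If `D` and `D'` are inverse anti-equivalences, and so are `A` and `B`, then `D` followed by `A`
and `B` followed by `D'` are quasi-inverse. -/
theorem areQuasiInverse_comp {D A B : C ⥤ Cᵒᵖ} {D' : Cᵒᵖ ⥤ C} (e : D ⋙ D' ≅ 𝟭 C)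
    (e' : D'.rightOp ⋙ D.leftOp ≅ 𝟭 C) (i : A ⋙ B.leftOp ≅ 𝟭 C) (j : B ⋙ A.leftOp ≅ 𝟭 C) :
    AreQuasiInverse (D ⋙ A.leftOp) (B ⋙ D') := by
  refine ⟨⟨NatIso.ofComponents
      (fun X => D'.mapIso (i.app (D.obj X).unop).op.symm ≪≫ e.app X) fun {X Y} f => ?_⟩,
    ⟨NatIso.ofComponents
      (fun X => A.leftOp.mapIso (e'.app (B.obj X).unop).op.symm ≪≫ j.app X) fun {X Y} f => ?_⟩⟩
  · have h1 : B.map (A.map (D.map f).unop).unop ≫ (i.inv.app (D.obj Y).unop).op =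
        (i.inv.app (D.obj X).unop).op ≫ D.map f :=
      Quiver.Hom.unop_inj (i.inv.naturality (D.map f).unop).symm
    have h2 := e.hom.naturality f
    change D'.map (B.map (A.map (D.map f).unop).unop) ≫ D'.map (i.inv.app (D.obj Y).unop).op ≫
      e.hom.app Y = (D'.map (i.inv.app (D.obj X).unop).op ≫ e.hom.app X) ≫ f
    rw [← D'.map_comp_assoc, h1, D'.map_comp_assoc, Category.assoc]
    exact congrArg _ h2
  · have h1 : D.map (D'.map (B.map f)) ≫ (e'.inv.app (B.obj Y).unop).op =
        (e'.inv.app (B.obj X).unop).op ≫ B.map f :=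
      Quiver.Hom.unop_inj (e'.inv.naturality (B.map f).unop).symm
    have h2 := j.hom.naturality f
    change A.leftOp.map (D.map (D'.map (B.map f))) ≫
      A.leftOp.map (e'.inv.app (B.obj Y).unop).op ≫ j.hom.app Y =
        (A.leftOp.map (e'.inv.app (B.obj X).unop).op ≫ j.hom.app X) ≫ f
    rw [← A.leftOp.map_comp_assoc, h1, A.leftOp.map_comp_assoc, Category.assoc]
    exact congrArg _ h2

variable [MonoidalCategory C]

theorem leftDualIso_hom_evaluation {D D' A : C} (p : ExactPairing D A) (p' : ExactPairing D' A) :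
    A ◁ (leftDualIso p p').hom ≫ p'.evaluation = p.evaluation := by
  let : HasLeftDual A := ⟨D'⟩
  have h := @leftAdjointMate_comp_evaluation C _ _ A A ⟨D'⟩ ⟨D⟩ (𝟙 A)
  rw [id_whiskerRight, Category.id_comp] at h
  exact h

theorem rightDualIso_hom_evaluation {D A A' : C} (p : ExactPairing D A) (p' : ExactPairing D A') :
    (rightDualIso p p').hom ▷ D ≫ p'.evaluation = p.evaluation := by
  have h := @rightAdjointMate_comp_evaluation C _ _ D D ⟨A'⟩ ⟨A⟩ (𝟙 D)
  rw [whiskerLeft_id, Category.id_comp] at h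
  exact h

/-- The comparison of two dual objects commutes with transposes: `f` and `f'` are the transposes of
`g` for the two choices of duals. -/
theorem leftDualIso_naturality {X X' A Y Y' B : C} (pX : ExactPairing X A)
    (pX' : ExactPairing X' A) (pY : ExactPairing Y B) (pY' : ExactPairing Y' B) {f : X ⟶ Y}
    {f' : X' ⟶ Y'} {g : B ⟶ A} (h : B ◁ f ≫ pY.evaluation = g ▷ X ≫ pX.evaluation)
    (h' : B ◁ f' ≫ pY'.evaluation = g ▷ X' ≫ pX'.evaluation) :
    f' ≫ (leftDualIso pY' pY).hom = (leftDualIso pX' pX).hom ≫ f := by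
  refine (existsUnique_whiskerLeft_evaluation (D := Y) (A := B) _).unique ?_ rfl
  rw [whiskerLeft_comp_assoc, whiskerLeft_comp_assoc, h, leftDualIso_hom_evaluation, h',
    whisker_exchange_assoc, leftDualIso_hom_evaluation]

/-- The comparison of two dual objects commutes with transposes: `f` and `f'` are the transposes of
`g` for the two choices of duals. -/
theorem rightDualIso_naturality {X A A' Y B B' : C} (pX : ExactPairing X A)
    (pX' : ExactPairing X A') (pY : ExactPairing Y B) (pY' : ExactPairing Y B') {f : A ⟶ B}
    {f' : A' ⟶ B'} {g : Y ⟶ X} (h : f ▷ Y ≫ pY.evaluation = A ◁ g ≫ pX.evaluation)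
    (h' : f' ▷ Y ≫ pY'.evaluation = A' ◁ g ≫ pX'.evaluation) :
    f' ≫ (rightDualIso pY' pY).hom = (rightDualIso pX' pX).hom ≫ f := by
  refine (existsUnique_whiskerRight_evaluation (D := Y) (A := B) _).unique ?_ rfl
  rw [comp_whiskerRight_assoc, comp_whiskerRight_assoc, h, rightDualIso_hom_evaluation, h',
    ← whisker_exchange_assoc, rightDualIso_hom_evaluation]

variable [RigidCategory C]

variable (C) in
/-- Every object is the right dual of its left dual. -/
def leftDualRightDualIso : (leftDual C).rightOp ⋙ rightDual C ≅ 𝟭 C :=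
  NatIso.ofComponents (fun Z => leftDualIso (LeftRigidCategory.leftDual (Zᘁ)).exact
      HasRightDual.exact) (fun f => leftDualIso_naturality _ _ _ _
    (rightAdjointMate_comp_evaluation f).symm
    (@leftAdjointMate_comp_evaluation _ _ _ _ _ (LeftRigidCategory.leftDual _)
      (LeftRigidCategory.leftDual _) (fᘁ)))

variable (C) in
/-- Every object is the left dual of its right dual. -/
def rightDualLeftDualIso : (rightDual C).rightOp ⋙ leftDual C ≅ 𝟭 C :=
  NatIso.ofComponents (fun Z => rightDualIso (RightRigidCategory.rightDual (ᘁZ : C)).exact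
      HasLeftDual.exact) (fun f => rightDualIso_naturality _ _ _ _
    (leftAdjointMate_comp_evaluation f).symm
    (@rightAdjointMate_comp_evaluation _ _ _ _ _ (RightRigidCategory.rightDual _)
      (RightRigidCategory.rightDual _) (ᘁf)))

/-- For `A` contravariant, the right dual of the left dual of `A` is `A`. -/
def rexclIso (A : C ⥤ Cᵒᵖ) : rexcl (A ⋙ leftDual C) ≅ (leftDual C).rightOp ⋙ A.leftOp :=
  NatIso.ofComponents (fun X => (leftDualRightDualIso C).app ((A.leftOp.obj (.op Xᘁ))))
    (fun f => (leftDualRightDualIso C).hom.naturality (A.leftOp.map (fᘁ).op))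

/-- For `A` contravariant, the left dual of the right dual of `A` is `A`. -/
def lexclIso (A : C ⥤ Cᵒᵖ) : lexcl (A ⋙ rightDual C) ≅ (rightDual C).rightOp ⋙ A.leftOp :=
  NatIso.ofComponents (fun X => (rightDualLeftDualIso C).app ((A.leftOp.obj (.op (ᘁX : C)))))
    (fun f => (rightDualLeftDualIso C).hom.naturality (A.leftOp.map (ᘁf).op))

end QuasiInverse

section InverseIntegral

variable {C : Type u} [Category.{v} C] [MonoidalCategory C] [RigidCategory C] {T : Monad C}
  [T.toFunctor.OplaxMonoidal]

/-- A quasi-inverse `R` of the anti-equivalence `E` given by universal pairings carries universal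
right integral forms, obtained by transport along `E (R X) ≅ X`. -/
theorem exists_isUniversalRightIntegral_of_pairing {E : Cᵒᵖ ⥤ C} {R : C ⥤ Cᵒᵖ}
    (κ : R ⋙ E ≅ 𝟭 C) (ω : ∀ X : C, T.obj X ⊗ T.obj (E.obj (.op X)) ⟶ 𝟙_ C)
    (h : ∀ X, IsUniversalPairing (ω X))
    (hn : ∀ {X Y : C} (f : X ⟶ Y), T.obj X ◁ T.map (E.map f.op) ≫ ω X =
        T.map f ▷ T.obj (E.obj (.op Y)) ≫ ω Y) :
    ∃ r : T.toFunctor ⟶ R ⋙ rightDual C, IsUniversalRightIntegral T r := by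
  have hform {W Z Z' : C} (g : Z ⟶ Z') {p : W ⊗ T.obj Z' ⟶ 𝟙_ C} (hp : IsRightForm T p) :
      IsRightForm T (W ◁ T.map g ≫ p) := by
    unfold IsRightForm at *
    rw [rightExtend_whiskerLeft _ (freeRightCoact_naturality g), hp, Category.assoc]
  let k (X : C) : X ≅ E.obj (.op (R.obj X).unop) := (κ.app X).symm
  refine exists_isUniversalRightIntegral R
    (fun X => (R.obj X).unop ◁ T.map (k X).hom ≫ rightRestrict (ω (R.obj X).unop))
    (fun {X Y} f => ?_) (fun X => hform _ (h _).isRightForm) (fun {X W} a ha => ?_)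
  · have e : (k X).hom ≫ E.map (R.map f) = f ≫ (k Y).hom := (κ.inv.naturality f).symm
    rw [← whisker_exchange_assoc]
    rw [← rightRestrict_comm (hn (R.map f).unop), ← whiskerLeft_comp_assoc,
      ← whiskerLeft_comp_assoc, ← T.map_comp, ← T.map_comp]
    exact congrArg (fun t => (R.obj Y).unop ◁ T.map t ≫ rightRestrict (ω (R.obj Y).unop)) e
  · obtain ⟨f, hf, hf'⟩ := (h _).existsUnique_right _ (hform (k X).inv ha)
    have e (g : W ⟶ (R.obj X).unop) : g ▷ T.obj X ≫ (R.obj X).unop ◁ T.map (k X).hom ≫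
        rightRestrict (ω (R.obj X).unop) = W ◁ T.map (k X).hom ≫ g ▷ _ ≫ rightRestrict _ :=
      (whisker_exchange_assoc _ _ _).symm
    refine ⟨f, ?_, fun g hg => hf' g ?_⟩
    · dsimp only at hf ⊢
      rw [e, hf, ← whiskerLeft_comp_assoc, ← T.map_comp]
      simp
    · dsimp only at hg ⊢
      rw [← hg, e, ← whiskerLeft_comp_assoc, ← T.map_comp]
      simp

end InverseIntegral

end HopfMonad

theorem mainTheorem4 {C : Type u} [Category.{v} C] [MonoidalCategory C] [RigidCategory C]
    (T : Monad C) [T.toFunctor.OplaxMonoidal] [HopfMonad.IsHopfMonad T] :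
    (HasEqualizers C → PreservesLimitsOfShape WalkingParallelPair T.toFunctor →
      HopfMonad.HopfModulesAdmitPreservedCoinvariants T) ∧
    (HopfMonad.HopfModulesAdmitPreservedCoinvariants T → T.toFunctor.ReflectsIsomorphisms →
      ∃ I_l I_r : C ⥤ C, I_l.IsEquivalence ∧ I_r.IsEquivalence ∧
        (∃ l : T.toFunctor ⟶ I_l, HopfMonad.IsUniversalLeftIntegral T l) ∧
        (∃ r : T.toFunctor ⟶ I_r, HopfMonad.IsUniversalRightIntegral T r) ∧
        HopfMonad.AreQuasiInverse (HopfMonad.rexcl I_l) I_r ∧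
        HopfMonad.AreQuasiInverse (HopfMonad.lexcl I_r) I_l) := by
  refine ⟨fun _ _ => ⟨fun _ => ⟨inferInstanceAs (HasEqualizer _ _), inferInstanceAs
    (PreservesLimit _ _)⟩, fun _ => ⟨inferInstanceAs (HasEqualizer _ _), inferInstanceAs
    (PreservesLimit _ _)⟩⟩, fun hT _ => ?_⟩
  obtain ⟨E, ω, h, hn, hE⟩ := HopfMonad.exists_pairingFunctor hT
  let R : C ⥤ Cᵒᵖ := E.inv
  let κ : R ⋙ E ≅ 𝟭 C := E.asEquivalence.counitIso
  let i : E.rightOp ⋙ R.leftOp ≅ 𝟭 C := NatIso.ofComponents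
    (fun X => (E.asEquivalence.unitIso.app (.op X)).unop)
    (fun f => Quiver.Hom.op_inj (E.asEquivalence.unitIso.hom.naturality f.op).symm)
  have hl : HopfMonad.AreQuasiInverse (HopfMonad.rexcl (E.rightOp ⋙ HopfMonad.leftDual C))
      (R ⋙ HopfMonad.rightDual C) :=
    (HopfMonad.areQuasiInverse_comp (HopfMonad.leftDualRightDualIso C)
      (HopfMonad.rightDualLeftDualIso C) i κ).of_iso (HopfMonad.rexclIso _)
  have hr : HopfMonad.AreQuasiInverse (HopfMonad.lexcl (R ⋙ HopfMonad.rightDual C))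
      (E.rightOp ⋙ HopfMonad.leftDual C) :=
    (HopfMonad.areQuasiInverse_comp (HopfMonad.rightDualLeftDualIso C)
      (HopfMonad.leftDualRightDualIso C) κ i).of_iso (HopfMonad.lexclIso _)
  exact ⟨_, _, hr.isEquivalence, hl.isEquivalence,
    HopfMonad.exists_isUniversalLeftIntegral E.rightOp
      (fun X => HopfMonad.leftRestrict (ω X)) (fun f => HopfMonad.leftRestrict_comm (hn f))
      (fun X => (h X).isLeftForm) (fun a ha => (h _).existsUnique_left a ha),
    HopfMonad.exists_isUniversalRightIntegral_of_pairing κ ω h hn, hl, hr⟩
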